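/- **Setting.** Let $E$ be a finite-dimensional complex Hilbert space, and let $\|\cdot\|$ denote the operator (spectral) norm. Let $H(s)$, $s\in[0,1]$, be a path of self-adjoint operators on $E$ that is twice differentiable on $[0,1]$ (one-sided at the endpoints), let $\lambda_0:[0,1]\to\mathbb R$ be continuous with $\lambda_0(s)$ an eigenvalue of $H(s)$ (possibly degenerate), and let $g_0:[0,1]\to(0,\infty)$ be absolutely continuous such that $[\lambda_0(s)-g_0(s),\lambda_0(s)+g_0(s)]\cap\sigma(H(s))=\{\lambda_0(s)\}$ for all $s$. Let $P(s)$ be the orthogonal projector onto the $\lambda_0(s)$-eigenspace of $H(s)$, let $(\cdot)^+$ denote the Moore–Penrose pseudoinverse, and put $C(s)=[P'(s),(H(s)-\lambda_0(s)I)^+]$. For a schedule $K$ with derivative $K'$, an *evolution along $K$* is a solution $\rho$ on $[0,1]$ of $\rho'(s)=-iK'(s)[H(s),\rho(s)]$ whose initial value $\rho(0)$ is a density operator with $\mathrm{Tr}[P(0)\rho(0)]=1$. The final fidelity is $\mathrm{Tr}[P(1)\rho(1)]$, and, with $K(0)=0$, the total time is $T=K(1)=\int_0^1K'(s)\,ds$.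 **(A) Error bound.** $P$ and $C$ are differentiable on $[0,1]$, and for every differentiable $K$ on $[0,1]$ with $K'>0$ and $K'$ absolutely continuous, and every evolution $\rho$ along $K$, $$1-\mathrm{Tr}[P(1)\rho(1)]\le \frac{\|C(1)\|}{K'(1)}+\int_0^1\frac{\|C'(s)\|}{K'(s)}\,ds+\int_0^1\Big|\Big(\frac1{K'}\Big)'(s)\Big|\,\|C(s)\|\,ds ,$$ where the integrals of nonnegative functions may be $+\infty$. **(B) Running time.** Let $1\le p\le 2$, $\varepsilon>0$, let $g_{\min}>0$ be a lower bound for the spectral gap, i.e. $g_{\min}\le|\mu-\lambda_0(s)|$ for all $s\in[0,1]$ and all $\mu\in\sigma(H(s))\setminus\{\lambda_0(s)\}$ (for instance the minimal gap itself, or $\min g_0$), and let $B_1,B_2$ satisfy $$\int_0^1 g_0(s)^{-p}\,ds\le B_1\,g_{\min}^{1-p},\qquad \int_0^1 g_0(s)^{p-3}\,ds\le B_2\,g_{\min}^{p-2}.$$ Let $c$ be any real number such that, for almost every $s\in[0,1]$, $$4\|H'(s)\|+40\|H'(s)\|^2B_2+4\|H''(s)\|+6p\,|g_0'(s)|\,\|H'(s)\|\,B_2\le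 c .$$ Then for the schedule $K$ with $K(0)=0$ and $$K'(s)=\frac1\varepsilon\cdot\frac{c}{g_0(s)^p\,g_{\min}^{2-p}}\qquad(s\in[0,1])$$ the total time is $T=K(1)=\int_0^1K'(s)\,ds\le \dfrac{c\,B_1}{\varepsilon\,g_{\min}}$, and every evolution $\rho$ along $K$ has final fidelity $\mathrm{Tr}[P(1)\rho(1)]\ge 1-\varepsilon$. -/

import Mathlib

open Set MeasureTheory
open scoped ENNReal

namespace Adiabatic

noncomputable section

variable {E : Type*} [NormedAddCommGroup E] [InnerProductSpace ℂ E] [FiniteDimensional ℂ E]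
  [CompleteSpace E]

/-- The orthogonal projector onto the eigenspace of `A` for the (real) number `lam`. -/
def eigenProj (A : E →L[ℂ] E) (lam : ℝ) : E →L[ℂ] E :=
  (Module.End.eigenspace (A : E →ₗ[ℂ] E) (lam : ℂ)).starProjection

/-- The distance from `lam` to the rest of the (real) spectrum of `A`; it is `⊤` when the spectrum
contains no other point. -/
def spectralGap (A : E →L[ℂ] E) (lam : ℝ) : ℝ≥0∞ :=
  Metric.infEDist lam (spectrum ℝ A \ {lam})

/-- The trace `Tr[P ρ]` (its real part; the trace is real for self-adjoint `P` and `ρ`). -/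
def fidelity (P ρ : E →L[ℂ] E) : ℝ :=
  (LinearMap.trace ℂ E ((P * ρ : E →L[ℂ] E) : E →ₗ[ℂ] E)).re

/-- Density operators: positive semidefinite operators of trace one. -/
def IsDensity (ρ : E →L[ℂ] E) : Prop :=
  ρ.IsPositive ∧ LinearMap.trace ℂ E (ρ : E →ₗ[ℂ] E) = 1

/-- A twice differentiable path `H` of Hamiltonians on `[0, 1]` (with derivatives `H₁`, `H₂`,
one-sided at the endpoints), a continuous eigenvalue `lam`, and a positive lower bound `g₀` for the
gap around it: the spectrum meets `[lam - g₀, lam + g₀]` exactly in `lam`. -/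
structure IsGappedPath (H H₁ H₂ : ℝ → E →L[ℂ] E) (lam g₀ : ℝ → ℝ) : Prop where
  selfAdjoint : ∀ s ∈ Icc (0 : ℝ) 1, IsSelfAdjoint (H s)
  hasDeriv : ∀ s ∈ Icc (0 : ℝ) 1, HasDerivWithinAt H (H₁ s) (Icc 0 1) s
  hasDeriv₂ : ∀ s ∈ Icc (0 : ℝ) 1, HasDerivWithinAt H₁ (H₂ s) (Icc 0 1) s
  continuousOn_lam : ContinuousOn lam (Icc 0 1)
  hasEigenvalue : ∀ s ∈ Icc (0 : ℝ) 1,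
    Module.End.HasEigenvalue (H s : E →ₗ[ℂ] E) (lam s : ℂ)
  gap_pos : ∀ s ∈ Icc (0 : ℝ) 1, 0 < g₀ s
  isolated : ∀ s ∈ Icc (0 : ℝ) 1,
    Icc (lam s - g₀ s) (lam s + g₀ s) ∩ spectrum ℝ (H s) = {lam s}

/-- `ρ` evolves under `H` along a schedule with derivative `K₁`, from a density operator that is
supported on the eigenspace of `H 0` for `lam 0`:
`ρ' = -i K₁ [H, ρ]` on `[0, 1]` and `Tr[P(0) ρ(0)] = 1`. -/
structure IsEvolution (H : ℝ → E →L[ℂ] E) (lam K₁ : ℝ → ℝ) (ρ : ℝ → E →L[ℂ] E) : Prop where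
  density_zero : IsDensity (ρ 0)
  fidelity_zero : fidelity (eigenProj (H 0) (lam 0)) (ρ 0) = 1
  hasDeriv : ∀ s ∈ Icc (0 : ℝ) 1,
    HasDerivWithinAt ρ ((-(Complex.I * (K₁ s : ℂ))) • ⁅H s, ρ s⁆) (Icc 0 1) s

/-- The Moore-Penrose pseudoinverse of a self-adjoint operator: on each eigenvector with eigenvalue
`x ≠ 0` it is multiplication by `x⁻¹`, and it vanishes on the kernel. -/
def pinv (A : E →L[ℂ] E) : E →L[ℂ] E :=
  cfc (fun x : ℝ => x⁻¹) A

/-- The pseudoinverse satisfies the four Penrose equations, which characterize it. -/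
theorem pinv_penrose {A : E →L[ℂ] E} (hA : IsSelfAdjoint A) :
    A * pinv A * A = A ∧ pinv A * A * pinv A = pinv A ∧
      IsSelfAdjoint (A * pinv A) ∧ IsSelfAdjoint (pinv A * A) := by
  have hfin : (spectrum ℝ A).Finite := by
    have : FiniteDimensional ℂ (E →L[ℂ] E) := inferInstance
    have : Module.Finite ℝ (E →L[ℂ] E) := Module.Finite.trans ℂ _
    have hint : IsIntegral ℝ A := IsIntegral.of_finite ℝ A
    refine ((minpoly ℝ A).rootSet_finite ℝ).subset fun x hx => ?_
    rw [Polynomial.mem_rootSet]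
    refine ⟨minpoly.ne_zero hint, ?_⟩
    have h := spectrum.subset_polynomial_aeval A (minpoly ℝ A) ⟨x, hx, rfl⟩
    rw [minpoly.aeval] at h
    by_contra h0
    exact h (by simpa [spectrum.mem_resolventSet_iff] using (isUnit_iff_ne_zero.mpr h0).map (algebraMap ℝ (E →L[ℂ] E)))
  have hc : ∀ f : ℝ → ℝ, ContinuousOn f (spectrum ℝ A) := fun f => hfin.continuousOn f
  have hl : ∀ f : ℝ → ℝ, A * cfc f A = cfc (fun x : ℝ => x * f x) A := fun f => by
    rw [cfc_mul (fun x : ℝ => x) f A (hc _) (hc _), cfc_id' ℝ A]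
  have hr : ∀ f : ℝ → ℝ, cfc f A * A = cfc (fun x : ℝ => f x * x) A := fun f => by
    rw [cfc_mul f (fun x : ℝ => x) A (hc _) (hc _), cfc_id' ℝ A]
  unfold pinv
  refine ⟨?_, ?_, ?_, ?_⟩
  · rw [hl, hr]
    simp only [mul_inv_mul_cancel, cfc_id' ℝ A]
  · rw [hr, ← cfc_mul _ _ A (hc _) (hc _)]
    refine cfc_congr fun x _ => ?_
    by_cases hx : x = 0 <;> simp [hx]
  · rw [hl]
    exact cfc_predicate _ _
  · rw [hr]
    exact cfc_predicate _ _

/-- The commutator `[P', (H - lam)⁺]` along the path, where `P` is the spectral projector. -/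
def gapCommutator (H : ℝ → E →L[ℂ] E) (lam : ℝ → ℝ) (s : ℝ) : E →L[ℂ] E :=
  ⁅derivWithin (fun t => eigenProj (H t) (lam t)) (Icc 0 1) s,
    pinv (H s - algebraMap ℝ (E →L[ℂ] E) (lam s))⁆

end

end Adiabatic

open Adiabatic

/-!
Write `A(s) = H(s) - λ₀(s)`, `P(s)` for the projector onto its kernel, `S(s) = A(s)⁺`, and
`C = [P', S]`.

*Differentiability.* The relations `A P = P A = S P = P S = 0` and `S A = A S = 1 - P` give the exact
identity `P(t) - P₀ = -S₀ (A(t) - A₀) P(t) - P₀ (A(t) - A₀) S(t)` (`proj_sub_proj`), where the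
subscript marks the value at a fixed point. Since the gap keeps `S` bounded, `P` is continuous, and
so is `S`, because `S + P = (A + P)⁻¹`. The identity `P₀ (A(t) - A₀) P(t) = 0`, tested on an
eigenvector, makes the eigenvalue differentiable (`exists_hasDerivWithinAt_lam`); dividing the first
identity by `t - s` then gives `P' = -S H' P - P H' S`, and the second resolvent identity gives `S'`.
No contour integral is needed. It follows that `C = X - X†` with `X = S² H' P`, which is again
differentiable. As `X` maps the range of `P` to its complement, `‖C‖ ≤ ‖H'‖ ‖S‖²`, and the same
principle (`norm_sub_star_le`), applied to the off-diagonal part of `C'`, yields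
`‖C'‖ ≤ 8 ‖H'‖² ‖S‖³ + ‖H''‖ ‖S‖²`.

*Error bound.* The fidelity `F = Tr(P ρ)` satisfies `F' = Tr(P' ρ)`, since `P` commutes with `H`.
Moreover `P' = [C, H]`, so that `K' F' = Tr(i C ρ')`: the function `v = Re (i Tr(C ρ))` has the
derivative `K' F' + Re (i Tr(C' ρ))`. Dividing by `K'` and integrating by parts
(`ofReal_sub_le_of_mul_deriv`) leaves three terms, in which `|Tr(C ρ)| ≤ ‖C‖` because `ρ(s)` is a
density operator (`SolvesVonNeumann.isDensity`). The boundary term at `0` vanishes, since `ρ(0)` lives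
on the range of `P(0)` and `P C P = 0`.

*Running time.* With `δ = max g₀ gmin` one has `‖S‖ ≤ δ⁻¹`, hence `g₀ᵖ gmin²⁻ᵖ ‖S‖² ≤ 1` and
`g₀ᵖ gmin²⁻ᵖ ‖S‖³ ≤ w` for the weight `w = g₀ᵖ⁻³ gmin²⁻ᵖ`, whose integral is at most `B₂`. Inserting
the bounds on `C` and `C'`, the three error terms are at most `ε / 4`, `9 ε / 20` and `ε / 6`
(`one_sub_le_fidelity_of_pos`). If `c = 0` then `H' = 0` and the fidelity is conserved.
-/

set_option linter.unusedSectionVars false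

/-! ### Spectral projector and reduced resolvent of one operator -/

namespace Adiabatic

variable {E : Type*} [NormedAddCommGroup E] [InnerProductSpace ℂ E] [FiniteDimensional ℂ E]
  [CompleteSpace E]

theorem pinv_mul_comm {A : E →L[ℂ] E} (hA : IsSelfAdjoint A) : pinv A * A = A * pinv A := by
  have h := (cfc_commute_cfc (fun x : ℝ => x⁻¹) (fun x : ℝ => x) A).eq
  rwa [cfc_id' ℝ A] at h

theorem isSelfAdjoint_pinv (A : E →L[ℂ] E) : IsSelfAdjoint (pinv A) :=
  cfc_predicate _ _

/-- The algebraic relations between a self-adjoint operator `A`, the projector `P` onto its kernel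
and its pseudoinverse `S`. They hold for `A = H - λ₀`, and nothing else about the eigenvalue and
its eigenspace enters the differentiation below. -/
structure IsReduced (A P S : E →L[ℂ] E) : Prop where
  selfAdjoint : IsSelfAdjoint A
  selfAdjoint_proj : IsSelfAdjoint P
  selfAdjoint_pinv : IsSelfAdjoint S
  proj_mul_self : P * P = P
  mul_proj : A * P = 0
  proj_mul : P * A = 0
  pinv_mul_proj : S * P = 0
  proj_mul_pinv : P * S = 0
  pinv_mul : S * A = 1 - P
  mul_pinv : A * S = 1 - P

theorem isSelfAdjoint_sub_algebraMap {B : E →L[ℂ] E} (hB : IsSelfAdjoint B) (x : ℝ) :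
    IsSelfAdjoint (B - algebraMap ℝ (E →L[ℂ] E) x) :=
  hB.sub (IsSelfAdjoint.algebraMap _ (IsSelfAdjoint.all x))

theorem eigenProj_eq_one_sub {B : E →L[ℂ] E} (hB : IsSelfAdjoint B) (x : ℝ) :
    eigenProj B x = 1 - pinv (B - algebraMap ℝ (E →L[ℂ] E) x) *
      (B - algebraMap ℝ (E →L[ℂ] E) x) := by
  set A := B - algebraMap ℝ (E →L[ℂ] E) x with hAdef
  have hA : IsSelfAdjoint A := isSelfAdjoint_sub_algebraMap hB x
  obtain ⟨h1, -, -, -⟩ := pinv_penrose hA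
  have hmem : ∀ v : E, v ∈ Module.End.eigenspace (B : E →ₗ[ℂ] E) (x : ℂ) ↔ A v = 0 := fun v => by
    rw [Module.End.mem_eigenspace_iff, hAdef]
    simp [sub_eq_zero]
  ext v
  refine Submodule.eq_starProjection_of_mem_of_inner_eq_zero ?_ ?_
  · rw [hmem]
    have := congrArg (fun T : E →L[ℂ] E => T v) h1
    simp only [mul_apply_eq_comp] at this
    simp [this]
  · intro w hw
    rw [hmem] at hw
    have hadj : ∀ u, inner ℂ (A u) w = inner ℂ u (A w) :=
      fun u => (ContinuousLinearMap.isSelfAdjoint_iff_isSymmetric.mp hA) u w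
    rw [pinv_mul_comm hA]
    simp [hadj, hw]

theorem isReduced_eigenProj {B : E →L[ℂ] E} (hB : IsSelfAdjoint B) (x : ℝ) :
    IsReduced (B - algebraMap ℝ (E →L[ℂ] E) x) (eigenProj B x)
      (pinv (B - algebraMap ℝ (E →L[ℂ] E) x)) := by
  have hP := eigenProj_eq_one_sub hB x
  set A := B - algebraMap ℝ (E →L[ℂ] E) x with hAdef
  have hA : IsSelfAdjoint A := isSelfAdjoint_sub_algebraMap hB x
  obtain ⟨h1, h2, h3, h4⟩ := pinv_penrose hA
  have hc := pinv_mul_comm hA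
  have h5 : pinv A * A * A = A := by rw [hc, h1]
  rw [hP]
  clear_value A
  refine ⟨hA, (IsSelfAdjoint.one _).sub h4, isSelfAdjoint_pinv A, ?_, ?_, ?_, ?_, ?_, ?_, ?_⟩
  · have : pinv A * A * (pinv A * A) = pinv A * A := by rw [← mul_assoc, h2]
    rw [sub_mul, mul_sub, mul_sub, this]; simp
  · rw [mul_sub, mul_one, ← mul_assoc, h1, sub_self]
  · rw [sub_mul, one_mul, h5, sub_self]
  · rw [mul_sub, mul_one, hc, ← mul_assoc, h2, sub_self]
  · rw [sub_mul, one_mul, h2, sub_self]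
  · simp
  · rw [hc]; simp

theorem norm_pinv_le {B : E →L[ℂ] E} (x δ : ℝ) (hδ : 0 < δ)
    (h : ∀ y ∈ spectrum ℝ B, y ≠ x → δ ≤ |y - x|) :
    ‖pinv (B - algebraMap ℝ (E →L[ℂ] E) x)‖ ≤ δ⁻¹ := by
  refine norm_cfc_le (inv_nonneg.mpr hδ.le) fun y hy => ?_
  rcases eq_or_ne y 0 with rfl | hy0
  · simpa using hδ.le
  · have hy' : y + x ∈ spectrum ℝ B := by
      rw [← spectrum.add_mem_add_iff (r := y) (s := x)] at hy
      simpa [add_comm] using hy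
    have := h _ hy' (by simpa using hy0)
    rw [norm_inv, Real.norm_eq_abs]
    exact inv_anti₀ hδ (by simpa using this)

namespace IsReduced

variable {A P S : E →L[ℂ] E}

theorem add_mul_add (h : IsReduced A P S) : (A + P) * (S + P) = 1 := by
  rw [add_mul, mul_add, mul_add, h.mul_pinv, h.mul_proj, h.proj_mul_pinv, h.proj_mul_self]
  abel

theorem add_mul_add' (h : IsReduced A P S) : (S + P) * (A + P) = 1 := by
  rw [add_mul, mul_add, mul_add, h.pinv_mul, h.proj_mul, h.pinv_mul_proj, h.proj_mul_self]
  abel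

theorem norm_proj_le (h : IsReduced A P S) : ‖P‖ ≤ 1 :=
  IsStarProjection.norm_le P ⟨h.proj_mul_self, h.selfAdjoint_proj⟩

end IsReduced

/-- If `Y` maps the range of a projector into its orthogonal complement and vanishes on that
complement, antisymmetrizing costs no factor of two: `Y` and `Y†` act on orthogonal vectors and
have orthogonal images. -/
theorem norm_sub_star_le {P Y : E →L[ℂ] E} (hP : IsSelfAdjoint P) (hPP : P * P = P)
    (h1 : Y * P = Y) (h2 : P * Y = 0) : ‖Y - star Y‖ ≤ ‖Y‖ := by
  have h3 : star Y * P = 0 := by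
    have := congrArg star h2
    simpa [hP.star_eq] using this
  have h4 : P * star Y = star Y := by
    have := congrArg star h1
    simpa [hP.star_eq] using this
  have hinner : ∀ u v : E, inner ℂ (P u) v = inner ℂ u (P v) :=
    fun u v => (ContinuousLinearMap.isSelfAdjoint_iff_isSymmetric.mp hP) u v
  have pyth : ∀ v : E, ∀ w : E, P v = 0 → P w = w → ‖v + w‖ ^ 2 = ‖v‖ ^ 2 + ‖w‖ ^ 2 := by
    intro v w hv hw
    have : inner ℂ v w = 0 := by rw [← hw, ← hinner, hv, inner_zero_left]
    have := norm_add_sq_eq_norm_sq_add_norm_sq_of_inner_eq_zero v w this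
    nlinarith
  refine ContinuousLinearMap.opNorm_le_bound _ (norm_nonneg _) fun v => ?_
  have e1 : Y v = Y (P v) := by conv_lhs => rw [← h1, mul_apply_eq_comp]
  have e2 : star Y v = star Y (v - P v) := by
    have : star Y (P v) = 0 := by rw [← mul_apply_eq_comp, h3]; rfl
    rw [map_sub, this, sub_zero]
  have e3 : P (Y v) = 0 := by rw [← mul_apply_eq_comp, h2]; rfl
  have e4 : P (star Y v) = star Y v := by rw [← mul_apply_eq_comp, h4]
  have e5 : P (P v) = P v := by rw [← mul_apply_eq_comp, hPP]
  have p1 := pyth (Y v) (-star Y v) e3 (by rw [map_neg, e4])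
  have p2 := pyth (v - P v) (P v) (by rw [map_sub, e5, sub_self]) e5
  have n1 : ‖Y v‖ ≤ ‖Y‖ * ‖P v‖ := by rw [e1]; exact Y.le_opNorm _
  have n2 : ‖star Y v‖ ≤ ‖Y‖ * ‖v - P v‖ := by
    rw [e2, ← norm_star Y]; exact (star Y).le_opNorm _
  rw [sub_add_cancel] at p2
  rw [norm_neg, ← sub_eq_add_neg] at p1
  rw [sub_apply]
  refine le_of_sq_le_sq ?_ (by positivity)
  rw [p1, mul_pow, p2]
  have := pow_le_pow_left₀ (norm_nonneg _) n1 2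
  have := pow_le_pow_left₀ (norm_nonneg _) n2 2
  nlinarith

end Adiabatic

/-! ### Differentiating curves of reduced resolvents -/

namespace Adiabatic

open Filter Topology

variable {E : Type*} [NormedAddCommGroup E] [InnerProductSpace ℂ E] [FiniteDimensional ℂ E]
  [CompleteSpace E]

section Curves

variable {A P S : ℝ → E →L[ℂ] E} {I : Set ℝ} {s₀ : ℝ}

/-- An exact formula for the difference of two spectral projectors: the first-order perturbation
formula with the second argument left unexpanded, so that no remainder term has to be estimated. -/
theorem proj_sub_proj {A P S A₀ P₀ S₀ : E →L[ℂ] E} (h : IsReduced A P S)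
    (h₀ : IsReduced A₀ P₀ S₀) :
    P - P₀ = -(S₀ * (A - A₀) * P) - P₀ * (A - A₀) * S := by
  have e1 : S₀ * (A - A₀) * P = -((1 - P₀) * P) := by
    rw [mul_sub, sub_mul, mul_assoc, h.mul_proj, h₀.pinv_mul]; simp
  have e2 : P₀ * (A - A₀) * S = P₀ * (1 - P) := by
    rw [mul_sub, sub_mul, mul_assoc, h.mul_pinv, h₀.proj_mul]; simp
  rw [e1, e2]; noncomm_ring

theorem proj_mul_sub_mul_proj {A P S A₀ P₀ S₀ : E →L[ℂ] E} (h : IsReduced A P S)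
    (h₀ : IsReduced A₀ P₀ S₀) : P₀ * (A - A₀) * P = 0 := by
  rw [mul_sub, sub_mul, mul_assoc, h.mul_proj, h₀.proj_mul]; simp

/-- The second resolvent identity for `(A + P)⁻¹ = S + P`. -/
theorem resolvent_sub_resolvent {A P S A₀ P₀ S₀ : E →L[ℂ] E} (h : IsReduced A P S)
    (h₀ : IsReduced A₀ P₀ S₀) :
    (S + P) - (S₀ + P₀) = -((S + P) * ((A + P) - (A₀ + P₀)) * (S₀ + P₀)) := by
  rw [mul_sub, sub_mul, h.add_mul_add', mul_assoc (S + P), h₀.add_mul_add]; simp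

theorem tendsto_mul_of_norm_le {l : Filter ℝ} {f g : ℝ → E →L[ℂ] E} {M : ℝ}
    (hf : Tendsto f l (𝓝 0)) (hg : ∀ᶠ s in l, ‖g s‖ ≤ M) :
    Tendsto (fun s => f s * g s) l (𝓝 0) :=
  hf.zero_mul_isBoundedUnder_le ⟨M, by simpa using hg⟩

theorem tendsto_norm_le_mul {l : Filter ℝ} {f g : ℝ → E →L[ℂ] E} {M : ℝ}
    (hf : Tendsto f l (𝓝 0)) (hg : ∀ᶠ s in l, ‖g s‖ ≤ M) :
    Tendsto (fun s => g s * f s) l (𝓝 0) :=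
  isBoundedUnder_le_mul_tendsto_zero ⟨M, by simpa using hg⟩ hf

theorem continuousWithinAt_proj (hs₀ : s₀ ∈ I) (h : ∀ s ∈ I, IsReduced (A s) (P s) (S s))
    (hA : ContinuousWithinAt A I s₀) {M : ℝ} (hM : ∀ᶠ s in 𝓝[I] s₀, ‖S s‖ ≤ M) :
    ContinuousWithinAt P I s₀ := by
  have h0 : Tendsto (fun s => A s - A s₀) (𝓝[I] s₀) (𝓝 0) := by
    have := hA.tendsto.sub_const (A s₀)
    rwa [sub_self] at this
  have hP : ∀ᶠ s in 𝓝[I] s₀, ‖P s‖ ≤ 1 :=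
    eventually_nhdsWithin_of_forall fun s hs => (h s hs).norm_proj_le
  have e1 : Tendsto (fun s => S s₀ * (A s - A s₀) * P s) (𝓝[I] s₀) (𝓝 0) :=
    tendsto_mul_of_norm_le (by simpa using h0.const_mul (S s₀)) hP
  have e2 : Tendsto (fun s => P s₀ * (A s - A s₀) * S s) (𝓝[I] s₀) (𝓝 0) :=
    tendsto_mul_of_norm_le (by simpa using h0.const_mul (P s₀)) hM
  have e3 : Tendsto (fun s => P s - P s₀) (𝓝[I] s₀) (𝓝 0) := by
    have := e1.neg.sub e2
    simp only [neg_zero, sub_zero] at this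
    refine this.congr' ?_
    exact eventually_nhdsWithin_of_forall fun s hs => (proj_sub_proj (h s hs) (h s₀ hs₀)).symm
  have := e3.add_const (P s₀)
  simpa [ContinuousWithinAt] using this

theorem continuousWithinAt_pinv (hs₀ : s₀ ∈ I) (h : ∀ s ∈ I, IsReduced (A s) (P s) (S s))
    (hA : ContinuousWithinAt A I s₀) {M : ℝ} (hM : ∀ᶠ s in 𝓝[I] s₀, ‖S s‖ ≤ M) :
    ContinuousWithinAt S I s₀ := by
  have hPc := continuousWithinAt_proj hs₀ h hA hM
  have hR : ∀ᶠ s in 𝓝[I] s₀, ‖S s + P s‖ ≤ M + 1 := by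
    filter_upwards [hM, self_mem_nhdsWithin] with s h1 h2
    exact norm_add_le_of_le h1 (h s h2).norm_proj_le
  have h0 : Tendsto (fun s => (A s + P s) - (A s₀ + P s₀)) (𝓝[I] s₀) (𝓝 0) := by
    have := (hA.add hPc).tendsto.sub_const (A s₀ + P s₀)
    simpa using this
  have e1 := ((tendsto_norm_le_mul h0 hR).mul_const (S s₀ + P s₀)).neg
  have e2 : Tendsto (fun s => (S s + P s) - (S s₀ + P s₀)) (𝓝[I] s₀) (𝓝 0) := by
    rw [zero_mul, neg_zero] at e1
    refine e1.congr' ?_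
    exact eventually_nhdsWithin_of_forall fun s hs =>
      (resolvent_sub_resolvent (h s hs) (h s₀ hs₀)).symm
  have := (e2.add_const (S s₀ + P s₀)).sub hPc.tendsto
  simpa [ContinuousWithinAt] using this

variable {D : E →L[ℂ] E}

theorem tendsto_slope_mul {F G K : ℝ → E →L[ℂ] E} {F' : E →L[ℂ] E}
    (hF : HasDerivWithinAt F F' I s₀) (hG : ContinuousWithinAt G I s₀)
    (hK : ContinuousWithinAt K I s₀) :
    Tendsto (fun s => G s * slope F s₀ s * K s) (𝓝[I \ {s₀}] s₀) (𝓝 (G s₀ * F' * K s₀)) :=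
  ((hG.tendsto.mono_left (nhdsWithin_mono _ sdiff_subset)).mul
    (hasDerivWithinAt_iff_tendsto_slope.mp hF)).mul
    (hK.tendsto.mono_left (nhdsWithin_mono _ sdiff_subset))

/-- The diagonal block of the derivative of the shifted Hamiltonian vanishes: a degenerate
eigenvalue does not split along the path. -/
theorem proj_mul_deriv_mul_proj (hs₀ : s₀ ∈ I) (h : ∀ s ∈ I, IsReduced (A s) (P s) (S s))
    (hA : HasDerivWithinAt A D I s₀) {M : ℝ} (hM : ∀ᶠ s in 𝓝[I] s₀, ‖S s‖ ≤ M)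
    [hne : (𝓝[I \ {s₀}] s₀).NeBot] : P s₀ * D * P s₀ = 0 := by
  have hPc := continuousWithinAt_proj hs₀ h hA.continuousWithinAt hM
  have h1 := tendsto_slope_mul hA (continuousWithinAt_const (b := P s₀)) hPc
  refine tendsto_nhds_unique h1 (tendsto_const_nhds.congr' ?_)
  refine eventually_nhdsWithin_of_forall fun s hs => ?_
  simp only [slope_def_module]
  rw [mul_smul_comm, smul_mul_assoc, proj_mul_sub_mul_proj (h s hs.1) (h s₀ hs₀), smul_zero]

theorem hasDerivWithinAt_proj (hs₀ : s₀ ∈ I) (h : ∀ s ∈ I, IsReduced (A s) (P s) (S s))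
    (hA : HasDerivWithinAt A D I s₀) {M : ℝ} (hM : ∀ᶠ s in 𝓝[I] s₀, ‖S s‖ ≤ M) :
    HasDerivWithinAt P (-(S s₀ * D * P s₀) - P s₀ * D * S s₀) I s₀ := by
  have hPc := continuousWithinAt_proj hs₀ h hA.continuousWithinAt hM
  have hSc := continuousWithinAt_pinv hs₀ h hA.continuousWithinAt hM
  rw [hasDerivWithinAt_iff_tendsto_slope]
  refine ((tendsto_slope_mul hA (continuousWithinAt_const (b := S s₀)) hPc).neg.sub
    (tendsto_slope_mul hA (continuousWithinAt_const (b := P s₀)) hSc)).congr' ?_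
  refine eventually_nhdsWithin_of_forall fun s hs => ?_
  simp only [slope_def_module]
  rw [proj_sub_proj (h s hs.1) (h s₀ hs₀)]
  rw [mul_smul_comm, smul_mul_assoc, mul_smul_comm, smul_mul_assoc, smul_sub, smul_neg]

/-- The derivative of `S` is that of the inverse `(A + P)⁻¹ = S + P`, minus that of `P`; the
vanishing of the diagonal block `P A' P` brings it to this form. -/
theorem hasDerivWithinAt_pinv (hs₀ : s₀ ∈ I) (h : ∀ s ∈ I, IsReduced (A s) (P s) (S s))
    (hA : HasDerivWithinAt A D I s₀) {M : ℝ} (hM : ∀ᶠ s in 𝓝[I] s₀, ‖S s‖ ≤ M)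
    [hne : (𝓝[I \ {s₀}] s₀).NeBot] :
    HasDerivWithinAt S (-(S s₀ * D * S s₀) + S s₀ * S s₀ * D * P s₀ + P s₀ * D * S s₀ * S s₀)
      I s₀ := by
  have hPc := continuousWithinAt_proj hs₀ h hA.continuousWithinAt hM
  have hSc := continuousWithinAt_pinv hs₀ h hA.continuousWithinAt hM
  have hP := hasDerivWithinAt_proj hs₀ h hA hM
  have hPDP := proj_mul_deriv_mul_proj hs₀ h hA hM
  have hR : HasDerivWithinAt (fun s => S s + P s) (-((S s₀ + P s₀) *
      (D + (-(S s₀ * D * P s₀) - P s₀ * D * S s₀)) * (S s₀ + P s₀))) I s₀ := by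
    rw [hasDerivWithinAt_iff_tendsto_slope]
    refine (tendsto_slope_mul (hA.fun_add hP) (hSc.fun_add hPc)
      (continuousWithinAt_const (b := S s₀ + P s₀))).neg.congr' ?_
    refine eventually_nhdsWithin_of_forall fun s hs => ?_
    simp only [slope_def_module]
    rw [resolvent_sub_resolvent (h s hs.1) (h s₀ hs₀)]
    simp only [mul_smul_comm, smul_mul_assoc, smul_neg]
  have hS : S = fun s => (S s + P s) - P s := by ext1 s; simp
  rw [hS]
  refine (hR.sub hP).congr_deriv ?_
  have r := h s₀ hs₀
  simp only [add_sub_cancel_right]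
  have a1 : ∀ x, P s₀ * (P s₀ * x) = P s₀ * x := fun x => by rw [← mul_assoc, r.proj_mul_self]
  have a2 : ∀ x, S s₀ * (P s₀ * x) = 0 := fun x => by rw [← mul_assoc, r.pinv_mul_proj, zero_mul]
  have a3 : ∀ x, P s₀ * (S s₀ * x) = 0 := fun x => by rw [← mul_assoc, r.proj_mul_pinv, zero_mul]
  have a4 : P s₀ * (D * P s₀) = 0 := by rw [← mul_assoc, hPDP]
  simp only [mul_add, add_mul, mul_sub, sub_mul, neg_mul, mul_neg, mul_assoc, a1, a2, a3, a4,
    r.proj_mul_self, r.pinv_mul_proj, r.proj_mul_pinv, mul_zero, zero_mul]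
  abel

end Curves

end Adiabatic

/-! ### The eigenvalue, the projector and the reduced resolvent along a gapped path -/

namespace Adiabatic

open Filter Topology

variable {E : Type*} [NormedAddCommGroup E] [InnerProductSpace ℂ E] [FiniteDimensional ℂ E]
  [CompleteSpace E]

/-- The Hamiltonian shifted so that the followed eigenvalue sits at zero. -/
noncomputable def shifted (H : ℝ → E →L[ℂ] E) (lam : ℝ → ℝ) (s : ℝ) : E →L[ℂ] E :=
  H s - algebraMap ℝ (E →L[ℂ] E) (lam s)

/-- The projector onto the followed eigenspace. -/
noncomputable def proj (H : ℝ → E →L[ℂ] E) (lam : ℝ → ℝ) (s : ℝ) : E →L[ℂ] E :=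
  eigenProj (H s) (lam s)

/-- The pseudoinverse of the shifted Hamiltonian, that is, its reduced resolvent. -/
noncomputable def redRes (H : ℝ → E →L[ℂ] E) (lam : ℝ → ℝ) (s : ℝ) : E →L[ℂ] E :=
  pinv (shifted H lam s)

theorem isSelfAdjoint_of_hasDerivWithinAt {F : ℝ → E →L[ℂ] E} {F' : E →L[ℂ] E} {s : ℝ}
    (hs : s ∈ Icc (0 : ℝ) 1) (hF : ∀ t ∈ Icc (0 : ℝ) 1, IsSelfAdjoint (F t))
    (h : HasDerivWithinAt F F' (Icc 0 1) s) : IsSelfAdjoint F' := by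
  have h1 : HasDerivWithinAt F (star F') (Icc 0 1) s :=
    h.star.congr (fun t ht => (hF t ht).star_eq.symm) (hF s hs).star_eq.symm
  exact UniqueDiffWithinAt.eq_deriv _ (uniqueDiffOn_Icc zero_lt_one s hs) h1 h

theorem neBot_nhdsWithin_Icc_sdiff {s : ℝ} (hs : s ∈ Icc (0 : ℝ) 1) :
    (𝓝[Icc (0 : ℝ) 1 \ {s}] s).NeBot :=
  accPt_principal_iff_clusterPt.mp
    (uniqueDiffWithinAt_iff_accPt.mp (uniqueDiffOn_Icc zero_lt_one s hs))

namespace IsGappedPath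

variable {H H₁ H₂ : ℝ → E →L[ℂ] E} {lam g₀ : ℝ → ℝ} {s : ℝ}

theorem isReduced (hH : IsGappedPath H H₁ H₂ lam g₀) (s : ℝ) (hs : s ∈ Icc (0 : ℝ) 1) :
    IsReduced (shifted H lam s) (proj H lam s) (redRes H lam s) :=
  isReduced_eigenProj (hH.selfAdjoint s hs) _

theorem lt_abs_sub (hH : IsGappedPath H H₁ H₂ lam g₀) (hs : s ∈ Icc (0 : ℝ) 1) {y : ℝ}
    (hy : y ∈ spectrum ℝ (H s)) (hne : y ≠ lam s) : g₀ s < |y - lam s| := by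
  by_contra! hle
  obtain ⟨h1, h2⟩ := abs_le.mp hle
  have : y ∈ Icc (lam s - g₀ s) (lam s + g₀ s) ∩ spectrum ℝ (H s) :=
    ⟨⟨by linarith, by linarith⟩, hy⟩
  rw [hH.isolated s hs] at this
  exact hne this

theorem norm_redRes_le (hH : IsGappedPath H H₁ H₂ lam g₀) (hs : s ∈ Icc (0 : ℝ) 1) :
    ‖redRes H lam s‖ ≤ (g₀ s)⁻¹ :=
  norm_pinv_le _ _ (hH.gap_pos s hs) fun _ hy hne => (hH.lt_abs_sub hs hy hne).le

/-- The two lower bounds for the gap, `g₀` and `gmin`, are both used: neither dominates the other. -/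
theorem norm_redRes_le_of_le_spectralGap (hH : IsGappedPath H H₁ H₂ lam g₀)
    (hs : s ∈ Icc (0 : ℝ) 1) {gmin : ℝ}
    (hg : ENNReal.ofReal gmin ≤ spectralGap (H s) (lam s)) :
    ‖redRes H lam s‖ ≤ (max (g₀ s) gmin)⁻¹ := by
  refine norm_pinv_le _ _ (lt_max_of_lt_left (hH.gap_pos s hs)) fun y hy hne =>
    max_le (hH.lt_abs_sub hs hy hne).le ?_
  have h1 : ENNReal.ofReal gmin ≤ edist (lam s) y :=
    hg.trans (Metric.infEDist_le_edist_of_mem ⟨hy, hne⟩)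
  rw [edist_dist, dist_comm, Real.dist_eq, ENNReal.ofReal_le_ofReal_iff (abs_nonneg _)] at h1
  exact h1

theorem eventually_norm_redRes_le (hH : IsGappedPath H H₁ H₂ lam g₀)
    (hg : ContinuousOn g₀ (Icc 0 1)) (hs : s ∈ Icc (0 : ℝ) 1) :
    ∀ᶠ t in 𝓝[Icc 0 1] s, ‖redRes H lam t‖ ≤ (g₀ s / 2)⁻¹ := by
  have h0 := hH.gap_pos s hs
  filter_upwards [(hg s hs).eventually (lt_mem_nhds (half_lt_self h0)), self_mem_nhdsWithin]
    with t h1 h2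
  exact (hH.norm_redRes_le h2).trans (inv_anti₀ (by positivity) h1.le)

theorem exists_unit_vector (hH : IsGappedPath H H₁ H₂ lam g₀) (hs : s ∈ Icc (0 : ℝ) 1) :
    ∃ v : E, ‖v‖ = 1 ∧ proj H lam s v = v := by
  obtain ⟨v, hv⟩ := (hH.hasEigenvalue s hs).exists_hasEigenvector
  have hn : ‖v‖ ≠ 0 := norm_ne_zero_iff.mpr hv.2
  refine ⟨(‖v‖⁻¹ : ℂ) • v, by simp [norm_smul, hn], ?_⟩
  rw [map_smul]
  congr 1
  exact Submodule.starProjection_eq_self_iff.mpr hv.1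

theorem continuousWithinAt_shifted (hH : IsGappedPath H H₁ H₂ lam g₀) (hs : s ∈ Icc (0 : ℝ) 1) :
    ContinuousWithinAt (shifted H lam) (Icc 0 1) s :=
  (hH.hasDeriv s hs).continuousWithinAt.sub
    ((continuous_algebraMap ℝ (E →L[ℂ] E)).continuousAt.comp_continuousWithinAt
      (hH.continuousOn_lam s hs))

theorem continuousWithinAt_proj (hH : IsGappedPath H H₁ H₂ lam g₀)
    (hg : ContinuousOn g₀ (Icc 0 1)) (hs : s ∈ Icc (0 : ℝ) 1) :
    ContinuousWithinAt (proj H lam) (Icc 0 1) s :=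
  Adiabatic.continuousWithinAt_proj hs hH.isReduced (hH.continuousWithinAt_shifted hs)
    (hH.eventually_norm_redRes_le hg hs)

/-- The eigenvalue is differentiable: the identity `P₀ (A(t) - A₀) P(t) = 0`, tested on a unit
eigenvector, expresses its difference quotient through that of `H`. -/
theorem exists_hasDerivWithinAt_lam (hH : IsGappedPath H H₁ H₂ lam g₀)
    (hg : ContinuousOn g₀ (Icc 0 1)) (hs : s ∈ Icc (0 : ℝ) 1) :
    ∃ l : ℝ, HasDerivWithinAt lam l (Icc 0 1) s := by
  obtain ⟨v, hv1, hv⟩ := hH.exists_unit_vector hs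
  have hPc := hH.continuousWithinAt_proj hg hs
  let φ : (E →L[ℂ] E) → ℂ := fun T => inner ℂ v (T v)
  have hφ : Continuous φ := by fun_prop
  have hφ0 : φ (proj H lam s * proj H lam s) = 1 := by
    simp [φ, hv, hv1]
  have t1 : Tendsto (fun t => φ (proj H lam s * slope H s t * proj H lam t))
      (𝓝[Icc 0 1 \ {s}] s) (𝓝 (φ (proj H lam s * H₁ s * proj H lam s))) :=
    (hφ.tendsto _).comp
      (tendsto_slope_mul (hH.hasDeriv s hs) (continuousWithinAt_const (b := proj H lam s)) hPc)
  have t2 : Tendsto (fun t => φ (proj H lam s * proj H lam t))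
      (𝓝[Icc 0 1 \ {s}] s) (𝓝 1) := by
    rw [← hφ0]
    exact (hφ.tendsto _).comp ((hPc.tendsto.const_mul _).mono_left
      (nhdsWithin_mono _ sdiff_subset))
  refine ⟨(φ (proj H lam s * H₁ s * proj H lam s) / 1).re, ?_⟩
  rw [hasDerivWithinAt_iff_tendsto_slope]
  refine ((Complex.continuous_re.tendsto _).comp (t1.div t2 one_ne_zero)).congr' ?_
  filter_upwards [t2.eventually_ne one_ne_zero, self_mem_nhdsWithin] with t h0 ht
  have key : proj H lam s * slope H s t * proj H lam t =
      ((slope lam s t : ℝ) : ℂ) • (proj H lam s * proj H lam t) := by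
    have := proj_mul_sub_mul_proj (hH.isReduced t ht.1) (hH.isReduced s hs)
    have e : shifted H lam t - shifted H lam s =
        (H t - H s) - ((lam t - lam s : ℝ) : ℂ) • (1 : E →L[ℂ] E) := by
      simp only [shifted, Algebra.algebraMap_eq_smul_one, Complex.coe_smul, sub_smul]
      abel
    rw [e, mul_sub, sub_mul, sub_eq_zero, mul_smul_comm, mul_one, smul_mul_assoc] at this
    rw [slope_def_module, slope_def_module, mul_smul_comm, smul_mul_assoc, this, smul_eq_mul,
      Complex.ofReal_mul, mul_smul, Complex.coe_smul, Complex.coe_smul]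
  simp only [Function.comp_apply, Pi.div_apply]
  rw [key]
  have : φ (((slope lam s t : ℝ) : ℂ) • (proj H lam s * proj H lam t)) =
      ((slope lam s t : ℝ) : ℂ) * φ (proj H lam s * proj H lam t) := by
    simp only [φ, smul_apply, inner_smul_right]
  rw [this, mul_div_assoc, div_self h0, mul_one, Complex.ofReal_re]

theorem hasDerivWithinAt_shifted (hH : IsGappedPath H H₁ H₂ lam g₀) (hs : s ∈ Icc (0 : ℝ) 1)
    {l : ℝ} (hl : HasDerivWithinAt lam l (Icc 0 1) s) :
    HasDerivWithinAt (shifted H lam) (H₁ s - l • (1 : E →L[ℂ] E)) (Icc 0 1) s := by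
  have : shifted H lam = fun t => H t - lam t • (1 : E →L[ℂ] E) := by
    ext1 t; rw [shifted, Algebra.algebraMap_eq_smul_one]
  rw [this]
  exact (hH.hasDeriv s hs).sub (hl.smul_const _)

theorem proj_mul_H₁_mul_proj (hH : IsGappedPath H H₁ H₂ lam g₀)
    (hg : ContinuousOn g₀ (Icc 0 1)) (hs : s ∈ Icc (0 : ℝ) 1)
    {l : ℝ} (hl : HasDerivWithinAt lam l (Icc 0 1) s) :
    proj H lam s * H₁ s * proj H lam s = l • proj H lam s := by
  have := neBot_nhdsWithin_Icc_sdiff hs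
  have h := proj_mul_deriv_mul_proj hs hH.isReduced (hH.hasDerivWithinAt_shifted hs hl)
    (hH.eventually_norm_redRes_le hg hs)
  rw [mul_sub, sub_mul, sub_eq_zero, mul_smul_comm, mul_one, smul_mul_assoc,
    (hH.isReduced s hs).proj_mul_self] at h
  exact h

theorem abs_deriv_lam_le (hH : IsGappedPath H H₁ H₂ lam g₀)
    (hg : ContinuousOn g₀ (Icc 0 1)) (hs : s ∈ Icc (0 : ℝ) 1)
    {l : ℝ} (hl : HasDerivWithinAt lam l (Icc 0 1) s) : |l| ≤ ‖H₁ s‖ := by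
  obtain ⟨v, hv1, hv⟩ := hH.exists_unit_vector hs
  have h := congrArg (fun T : E →L[ℂ] E => ‖T v‖) (hH.proj_mul_H₁_mul_proj hg hs hl)
  simp only [mul_apply_eq_comp, hv, smul_apply, norm_smul, hv1, mul_one, Real.norm_eq_abs] at h
  rw [← h]
  refine ((proj H lam s).le_opNorm _).trans ?_
  refine (mul_le_mul (hH.isReduced s hs).norm_proj_le ((H₁ s).le_opNorm v) (norm_nonneg _)
    zero_le_one).trans ?_
  simp [hv1]

theorem hasDerivWithinAt_proj (hH : IsGappedPath H H₁ H₂ lam g₀)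
    (hg : ContinuousOn g₀ (Icc 0 1)) (hs : s ∈ Icc (0 : ℝ) 1) :
    HasDerivWithinAt (proj H lam) (-(redRes H lam s * H₁ s * proj H lam s) -
      proj H lam s * H₁ s * redRes H lam s) (Icc 0 1) s := by
  obtain ⟨l, hl⟩ := hH.exists_hasDerivWithinAt_lam hg hs
  refine (Adiabatic.hasDerivWithinAt_proj hs hH.isReduced (hH.hasDerivWithinAt_shifted hs hl)
    (hH.eventually_norm_redRes_le hg hs)).congr_deriv ?_
  have r := hH.isReduced s hs
  simp [mul_sub, sub_mul, r.pinv_mul_proj, r.proj_mul_pinv]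

theorem hasDerivWithinAt_redRes (hH : IsGappedPath H H₁ H₂ lam g₀)
    (hg : ContinuousOn g₀ (Icc 0 1)) (hs : s ∈ Icc (0 : ℝ) 1)
    {l : ℝ} (hl : HasDerivWithinAt lam l (Icc 0 1) s) :
    HasDerivWithinAt (redRes H lam)
      (-(redRes H lam s * (H₁ s - l • (1 : E →L[ℂ] E)) * redRes H lam s) +
        redRes H lam s * redRes H lam s * H₁ s * proj H lam s +
        proj H lam s * H₁ s * redRes H lam s * redRes H lam s) (Icc 0 1) s := by
  have := neBot_nhdsWithin_Icc_sdiff hs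
  refine (hasDerivWithinAt_pinv hs hH.isReduced (hH.hasDerivWithinAt_shifted hs hl)
    (hH.eventually_norm_redRes_le hg hs)).congr_deriv ?_
  have r := hH.isReduced s hs
  have e1 : redRes H lam s * redRes H lam s * proj H lam s = 0 := by
    rw [mul_assoc, r.pinv_mul_proj, mul_zero]
  simp [mul_sub, sub_mul, r.proj_mul_pinv, e1]

end IsGappedPath
end Adiabatic

/-! ### The commutator `[P', S]` and its derivative -/

namespace Adiabatic

variable {E : Type*} [NormedAddCommGroup E] [InnerProductSpace ℂ E] [FiniteDimensional ℂ E]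
  [CompleteSpace E]

/-- The block `S² H' P` of the commutator `[P', S]`, which maps the followed eigenspace into its
orthogonal complement; the commutator is this block minus its adjoint. -/
noncomputable def offBlock (H H₁ : ℝ → E →L[ℂ] E) (lam : ℝ → ℝ) (s : ℝ) : E →L[ℂ] E :=
  redRes H lam s * redRes H lam s * H₁ s * proj H lam s

/-- The part of the derivative of `S² B P` (with `B = H'`, `B₂ = H''`, `l` the derivative of the
eigenvalue) that maps the range of `P` into its complement. -/
noncomputable def derivOffBlock (S B B₂ P : E →L[ℂ] E) (l : ℝ) : E →L[ℂ] E :=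
  -(S * (B - l • (1 : E →L[ℂ] E)) * S * S * B * P) -
    S * S * (B - l • (1 : E →L[ℂ] E)) * S * B * P +
    l • (S * S * S * B * P) - S * S * B * S * B * P + S * S * B₂ * P

theorem norm_derivOffBlock_le {S B B₂ P : E →L[ℂ] E} {l d : ℝ} (hS : ‖S‖ ≤ d) (hP : ‖P‖ ≤ 1)
    (hl : |l| ≤ ‖B‖) :
    ‖derivOffBlock S B B₂ P l‖ ≤ 6 * ‖B‖ ^ 2 * d ^ 3 + ‖B₂‖ * d ^ 2 := by
  have hd : 0 ≤ d := (norm_nonneg _).trans hS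
  have hl1 : ‖l • (1 : E →L[ℂ] E)‖ ≤ ‖B‖ := by
    rw [norm_smul, Real.norm_eq_abs]
    have h1 : ‖(1 : E →L[ℂ] E)‖ ≤ 1 := ContinuousLinearMap.norm_id_le
    nlinarith [abs_nonneg l]
  have hD : ‖B - l • (1 : E →L[ℂ] E)‖ ≤ 2 * ‖B‖ := by
    refine (norm_sub_le _ _).trans ?_
    linarith
  have hB := le_refl ‖B‖
  have hB₂ := le_refl ‖B₂‖
  rw [derivOffBlock]
  generalize B - l • (1 : E →L[ℂ] E) = D at *
  have t1 : ‖S * D * S * S * B * P‖ ≤ d * (2 * ‖B‖) * d * d * ‖B‖ * 1 :=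
    norm_mul_le_of_le (norm_mul_le_of_le (norm_mul_le_of_le (norm_mul_le_of_le
      (norm_mul_le_of_le hS hD) hS) hS) hB) hP
  have t2 : ‖S * S * D * S * B * P‖ ≤ d * d * (2 * ‖B‖) * d * ‖B‖ * 1 :=
    norm_mul_le_of_le (norm_mul_le_of_le (norm_mul_le_of_le (norm_mul_le_of_le
      (norm_mul_le_of_le hS hS) hD) hS) hB) hP
  have t3 : ‖l • (S * S * S * B * P)‖ ≤ ‖B‖ * (d * d * d * ‖B‖ * 1) := by
    rw [norm_smul]
    exact mul_le_mul hl (norm_mul_le_of_le (norm_mul_le_of_le (norm_mul_le_of_le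
      (norm_mul_le_of_le hS hS) hS) hB) hP) (norm_nonneg _) (norm_nonneg _)
  have t4 : ‖S * S * B * S * B * P‖ ≤ d * d * ‖B‖ * d * ‖B‖ * 1 :=
    norm_mul_le_of_le (norm_mul_le_of_le (norm_mul_le_of_le (norm_mul_le_of_le
      (norm_mul_le_of_le hS hS) hB) hS) hB) hP
  have t5 : ‖S * S * B₂ * P‖ ≤ d * d * ‖B₂‖ * 1 :=
    norm_mul_le_of_le (norm_mul_le_of_le (norm_mul_le_of_le hS hS) hB₂) hP
  refine (norm_add_le_of_le (norm_sub_le_of_le (norm_add_le_of_le (norm_sub_le_of_le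
    ((norm_neg _).trans_le t1) t2) t3) t4) t5).trans_eq ?_
  ring

namespace IsGappedPath

variable {H H₁ H₂ : ℝ → E →L[ℂ] E} {lam g₀ : ℝ → ℝ} {s : ℝ}

theorem isSelfAdjoint_H₁ (hH : IsGappedPath H H₁ H₂ lam g₀) (hs : s ∈ Icc (0 : ℝ) 1) :
    IsSelfAdjoint (H₁ s) :=
  isSelfAdjoint_of_hasDerivWithinAt hs hH.selfAdjoint (hH.hasDeriv s hs)

theorem derivWithin_proj (hH : IsGappedPath H H₁ H₂ lam g₀)
    (hg : ContinuousOn g₀ (Icc 0 1)) (hs : s ∈ Icc (0 : ℝ) 1) :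
    derivWithin (proj H lam) (Icc 0 1) s = -(redRes H lam s * H₁ s * proj H lam s) -
      proj H lam s * H₁ s * redRes H lam s :=
  (hH.hasDerivWithinAt_proj hg hs).derivWithin (uniqueDiffOn_Icc zero_lt_one s hs)

theorem gapCommutator_eq (hH : IsGappedPath H H₁ H₂ lam g₀)
    (hg : ContinuousOn g₀ (Icc 0 1)) (hs : s ∈ Icc (0 : ℝ) 1) :
    gapCommutator H lam s = offBlock H H₁ lam s - star (offBlock H H₁ lam s) := by
  have r := hH.isReduced s hs
  have e : gapCommutator H lam s = ⁅derivWithin (proj H lam) (Icc 0 1) s, redRes H lam s⁆ := rfl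
  rw [e, hH.derivWithin_proj hg hs, Ring.lie_def, offBlock]
  simp only [star_mul, r.selfAdjoint_pinv.star_eq, r.selfAdjoint_proj.star_eq,
    (hH.isSelfAdjoint_H₁ hs).star_eq]
  have a2 : ∀ x, redRes H lam s * (proj H lam s * x) = 0 := fun x => by
    rw [← mul_assoc, r.pinv_mul_proj, zero_mul]
  simp only [sub_mul, mul_sub, neg_mul, mul_neg, mul_assoc, a2, r.proj_mul_pinv, mul_zero]
  abel

theorem norm_gapCommutator_le (hH : IsGappedPath H H₁ H₂ lam g₀)
    (hg : ContinuousOn g₀ (Icc 0 1)) (hs : s ∈ Icc (0 : ℝ) 1) {d : ℝ}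
    (hd : ‖redRes H lam s‖ ≤ d) : ‖gapCommutator H lam s‖ ≤ ‖H₁ s‖ * d ^ 2 := by
  have r := hH.isReduced s hs
  rw [hH.gapCommutator_eq hg hs]
  refine (norm_sub_star_le r.selfAdjoint_proj r.proj_mul_self ?_ ?_).trans ?_
  · rw [offBlock, mul_assoc, r.proj_mul_self]
  · simp only [offBlock, ← mul_assoc, r.proj_mul_pinv, zero_mul]
  · refine (norm_mul_le_of_le (norm_mul_le_of_le (norm_mul_le_of_le hd hd) le_rfl)
      r.norm_proj_le).trans_eq ?_
    ring

theorem hasDerivWithinAt_offBlock (hH : IsGappedPath H H₁ H₂ lam g₀)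
    (hg : ContinuousOn g₀ (Icc 0 1)) (hs : s ∈ Icc (0 : ℝ) 1) {l : ℝ}
    (hl : HasDerivWithinAt lam l (Icc 0 1) s) :
    HasDerivWithinAt (offBlock H H₁ lam)
      (derivOffBlock (redRes H lam s) (H₁ s) (H₂ s) (proj H lam s) l +
        star (offBlock H H₁ lam s) * redRes H lam s * H₁ s * proj H lam s -
        offBlock H H₁ lam s * H₁ s * redRes H lam s) (Icc 0 1) s := by
  have hS := hH.hasDerivWithinAt_redRes hg hs hl
  have hP := hH.hasDerivWithinAt_proj hg hs
  have r := hH.isReduced s hs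
  have hPBP := hH.proj_mul_H₁_mul_proj hg hs hl
  refine (((hS.fun_mul hS).fun_mul (hH.hasDeriv₂ s hs)).fun_mul hP).congr_deriv ?_
  simp only [derivOffBlock, offBlock, star_mul, r.selfAdjoint_pinv.star_eq,
    r.selfAdjoint_proj.star_eq, (hH.isSelfAdjoint_H₁ hs).star_eq]
  generalize H₁ s - l • (1 : E →L[ℂ] E) = D
  have a2 : ∀ x, redRes H lam s * (proj H lam s * x) = 0 := fun x => by
    rw [← mul_assoc, r.pinv_mul_proj, zero_mul]
  have a3 : ∀ x, proj H lam s * (redRes H lam s * x) = 0 := fun x => by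
    rw [← mul_assoc, r.proj_mul_pinv, zero_mul]
  have a4 : proj H lam s * (H₁ s * proj H lam s) = l • proj H lam s := by
    rw [← mul_assoc, hPBP]
  simp only [mul_add, add_mul, mul_sub, neg_mul, mul_neg, mul_assoc, a2, a3, a4,
    mul_smul_comm, mul_zero, zero_mul]
  abel

/-- The derivative of the commutator splits into an off-diagonal part, which obeys the sharp bound
for antisymmetrized off-diagonal operators, and the antisymmetrization of `S² H' P H' S`; the
remaining block `P H' S³ H' P` is self-adjoint and cancels. -/
theorem exists_hasDerivWithinAt_gapCommutator (hH : IsGappedPath H H₁ H₂ lam g₀)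
    (hg : ContinuousOn g₀ (Icc 0 1)) (hs : s ∈ Icc (0 : ℝ) 1) :
    ∃ C' : E →L[ℂ] E, HasDerivWithinAt (gapCommutator H lam) C' (Icc 0 1) s ∧
      ∀ d : ℝ, ‖redRes H lam s‖ ≤ d → ‖C'‖ ≤ 8 * ‖H₁ s‖ ^ 2 * d ^ 3 + ‖H₂ s‖ * d ^ 2 := by
  obtain ⟨l, hl⟩ := hH.exists_hasDerivWithinAt_lam hg hs
  have r := hH.isReduced s hs
  have hX := hH.hasDerivWithinAt_offBlock hg hs hl
  set Y := derivOffBlock (redRes H lam s) (H₁ s) (H₂ s) (proj H lam s) l with hY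
  set W := star (offBlock H H₁ lam s) * redRes H lam s * H₁ s * proj H lam s with hW
  set Z := offBlock H H₁ lam s * H₁ s * redRes H lam s with hZ
  have hWs : star W = W := by
    simp only [hW, offBlock, star_mul, r.selfAdjoint_pinv.star_eq,
      r.selfAdjoint_proj.star_eq, (hH.isSelfAdjoint_H₁ hs).star_eq, mul_assoc]
  have hC : HasDerivWithinAt (gapCommutator H lam) ((Y - star Y) - (Z - star Z)) (Icc 0 1) s := by
    refine ((hX.sub hX.star).congr (fun t ht => hH.gapCommutator_eq hg ht)
      (hH.gapCommutator_eq hg hs)).congr_deriv ?_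
    simp only [star_add, star_sub, hWs]
    abel
  refine ⟨_, hC, fun d hd => ?_⟩
  have hYn : ‖Y - star Y‖ ≤ ‖Y‖ := by
    refine norm_sub_star_le r.selfAdjoint_proj r.proj_mul_self ?_ ?_
    · simp only [hY, derivOffBlock, add_mul, sub_mul _ _ (proj H lam s), neg_mul, smul_mul_assoc,
        mul_assoc _ (proj H lam s) (proj H lam s), r.proj_mul_self]
    · have a3 : ∀ x, proj H lam s * (redRes H lam s * x) = 0 := fun x => by
        rw [← mul_assoc, r.proj_mul_pinv, zero_mul]
      simp only [hY, derivOffBlock, mul_add, mul_sub (proj H lam s), mul_neg, mul_smul_comm,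
        mul_assoc, a3, smul_zero, neg_zero, sub_zero, add_zero]
  have hZn : ‖Z‖ ≤ ‖H₁ s‖ ^ 2 * d ^ 3 := by
    refine (norm_mul_le_of_le (norm_mul_le_of_le (norm_mul_le_of_le (norm_mul_le_of_le
      (norm_mul_le_of_le hd hd) le_rfl) r.norm_proj_le) le_rfl) hd).trans_eq ?_
    ring
  have hYb := norm_derivOffBlock_le (B₂ := H₂ s) hd r.norm_proj_le (hH.abs_deriv_lam_le hg hs hl)
  have h1 : ‖Z - star Z‖ ≤ ‖Z‖ + ‖Z‖ := norm_sub_le_of_le le_rfl (norm_star Z).le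
  have h2 := norm_sub_le (Y - star Y) (Z - star Z)
  linarith

theorem differentiableOn_gapCommutator (hH : IsGappedPath H H₁ H₂ lam g₀)
    (hg : ContinuousOn g₀ (Icc 0 1)) : DifferentiableOn ℝ (gapCommutator H lam) (Icc 0 1) :=
  fun _ hs => (hH.exists_hasDerivWithinAt_gapCommutator hg hs).choose_spec.1.differentiableWithinAt

theorem norm_derivWithin_gapCommutator_le (hH : IsGappedPath H H₁ H₂ lam g₀)
    (hg : ContinuousOn g₀ (Icc 0 1)) (hs : s ∈ Icc (0 : ℝ) 1) {d : ℝ}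
    (hd : ‖redRes H lam s‖ ≤ d) :
    ‖derivWithin (gapCommutator H lam) (Icc 0 1) s‖ ≤
      8 * ‖H₁ s‖ ^ 2 * d ^ 3 + ‖H₂ s‖ * d ^ 2 := by
  obtain ⟨C', h1, h2⟩ := hH.exists_hasDerivWithinAt_gapCommutator hg hs
  rw [h1.derivWithin (uniqueDiffOn_Icc zero_lt_one s hs)]
  exact h2 d hd

/-- The derivative of the projector is the commutator of `gapCommutator` with the Hamiltonian:
this is what trades a factor of the gap for a factor of the running time. -/
theorem derivWithin_proj_eq_lie (hH : IsGappedPath H H₁ H₂ lam g₀)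
    (hg : ContinuousOn g₀ (Icc 0 1)) (hs : s ∈ Icc (0 : ℝ) 1) :
    derivWithin (proj H lam) (Icc 0 1) s = ⁅gapCommutator H lam s, H s⁆ := by
  have r := hH.isReduced s hs
  have e : ⁅gapCommutator H lam s, H s⁆ = ⁅gapCommutator H lam s, shifted H lam s⁆ := by
    rw [Ring.lie_def, Ring.lie_def, shifted, mul_sub, sub_mul, Algebra.commutes]
    abel
  rw [e, hH.gapCommutator_eq hg hs, hH.derivWithin_proj hg hs, Ring.lie_def, offBlock]
  simp only [star_mul, r.selfAdjoint_pinv.star_eq, r.selfAdjoint_proj.star_eq,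
    (hH.isSelfAdjoint_H₁ hs).star_eq]
  have a1 : ∀ x, shifted H lam s * (redRes H lam s * x) = x - proj H lam s * x := fun x => by
    rw [← mul_assoc, r.mul_pinv, sub_mul, one_mul]
  have a2 : ∀ x, proj H lam s * (redRes H lam s * x) = 0 := fun x => by
    rw [← mul_assoc, r.proj_mul_pinv, zero_mul]
  have a3 : ∀ x, shifted H lam s * (proj H lam s * x) = 0 := fun x => by
    rw [← mul_assoc, r.mul_proj, zero_mul]
  simp only [mul_sub, sub_mul, mul_assoc, a1, a2, a3, r.pinv_mul, r.proj_mul, r.pinv_mul_proj,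
    mul_one, mul_zero, sub_zero]
  abel

theorem commute_proj (hH : IsGappedPath H H₁ H₂ lam g₀) (hs : s ∈ Icc (0 : ℝ) 1) :
    proj H lam s * H s = H s * proj H lam s := by
  have r := hH.isReduced s hs
  have h1 := r.proj_mul
  have h2 := r.mul_proj
  rw [shifted, mul_sub, sub_eq_zero] at h1
  rw [shifted, sub_mul, sub_eq_zero] at h2
  rw [h1, h2, Algebra.commutes]

end IsGappedPath
end Adiabatic

/-! ### The von Neumann equation and density operators -/

namespace Adiabatic

open Polynomial

variable {E : Type*} [NormedAddCommGroup E] [InnerProductSpace ℂ E] [FiniteDimensional ℂ E]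
  [CompleteSpace E]

/-- The von Neumann equation `X' = -i k [H, X]` on `[0, 1]`, for an arbitrary operator `X`. -/
def SolvesVonNeumann (H : ℝ → E →L[ℂ] E) (k : ℝ → ℝ) (X : ℝ → E →L[ℂ] E) : Prop :=
  ∀ s ∈ Icc (0 : ℝ) 1,
    HasDerivWithinAt X ((-(Complex.I * (k s : ℂ))) • ⁅H s, X s⁆) (Icc 0 1) s

namespace SolvesVonNeumann

variable {H X Y : ℝ → E →L[ℂ] E} {k : ℝ → ℝ}

theorem add (hX : SolvesVonNeumann H k X) (hY : SolvesVonNeumann H k Y) :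
    SolvesVonNeumann H k (fun s => X s + Y s) := fun s hs => by
  refine ((hX s hs).fun_add (hY s hs)).congr_deriv ?_
  rw [← smul_add]
  congr 1
  simp only [Ring.lie_def]
  noncomm_ring

theorem sub (hX : SolvesVonNeumann H k X) (hY : SolvesVonNeumann H k Y) :
    SolvesVonNeumann H k (fun s => X s - Y s) := fun s hs => by
  refine ((hX s hs).fun_sub (hY s hs)).congr_deriv ?_
  rw [← smul_sub]
  congr 1
  simp only [Ring.lie_def]
  noncomm_ring

theorem mul (hX : SolvesVonNeumann H k X) (hY : SolvesVonNeumann H k Y) :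
    SolvesVonNeumann H k (fun s => X s * Y s) := fun s hs => by
  refine ((hX s hs).fun_mul (hY s hs)).congr_deriv ?_
  rw [smul_mul_assoc, mul_smul_comm, ← smul_add]
  congr 1
  simp only [Ring.lie_def]
  noncomm_ring

theorem const_real (r : ℝ) :
    SolvesVonNeumann H k (fun _ => algebraMap ℝ (E →L[ℂ] E) r) := fun s _ => by
  refine (hasDerivWithinAt_const _ _ _).congr_deriv ?_
  rw [Ring.lie_def, Algebra.commutes, sub_self, smul_zero]

theorem aeval (hX : SolvesVonNeumann H k X) (q : ℝ[X]) :
    SolvesVonNeumann H k (fun s => aeval (X s) q) := by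
  induction q using Polynomial.induction_on with
  | C a => simpa using const_real a
  | add p q hp hq => simpa using hp.add hq
  | monomial n a h =>
    have := h.mul hX
    simpa [pow_succ, mul_assoc] using this

theorem star (hX : SolvesVonNeumann H k X) (hH : ∀ s ∈ Icc (0 : ℝ) 1, IsSelfAdjoint (H s)) :
    SolvesVonNeumann H k (fun s => star (X s)) := fun s hs => by
  refine (hX s hs).star.congr_deriv ?_
  simp only [Ring.lie_def, star_smul, star_sub, star_mul, (hH s hs).star_eq, star_neg,
    Complex.star_def, Complex.conj_I, Complex.conj_ofReal]
  rw [← neg_sub (H s * _), smul_neg, ← neg_smul]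
  congr 1
  ring

/-- A solution of the von Neumann equation with zero initial value vanishes, by Grönwall. -/
theorem eq_zero (hX : SolvesVonNeumann H k X) (hH : ContinuousOn H (Icc 0 1))
    (hk : ContinuousOn k (Icc 0 1)) (h0 : X 0 = 0) : ∀ s ∈ Icc (0 : ℝ) 1, X s = 0 := by
  obtain ⟨M, hM⟩ := isCompact_Icc.exists_bound_of_continuousOn (hk.smul hH)
  refine eq_zero_of_abs_deriv_le_mul_abs_self_of_eq_zero_right (K := 2 * M)
    (f' := fun s => (-(Complex.I * (k s : ℂ))) • ⁅H s, X s⁆)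
    (fun s hs => (hX s hs).continuousWithinAt) (fun s hs => ?_) h0 (fun s hs => ?_)
  · exact (hX s (Ico_subset_Icc_self hs)).mono_of_mem_nhdsWithin (Icc_mem_nhdsGE_of_mem hs)
  · have h1 := hM s (Ico_subset_Icc_self hs)
    rw [Pi.smul_apply', norm_smul] at h1
    have h2 : ‖⁅H s, X s⁆‖ ≤ 2 * (‖H s‖ * ‖X s‖) := by
      rw [Ring.lie_def]
      refine (norm_sub_le_of_le (norm_mul_le _ _) (norm_mul_le _ _)).trans_eq ?_
      ring
    rw [norm_smul, norm_neg, norm_mul, Complex.norm_I, one_mul, Complex.norm_real]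
    calc ‖k s‖ * ‖⁅H s, X s⁆‖ ≤ ‖k s‖ * (2 * (‖H s‖ * ‖X s‖)) := by gcongr
      _ = 2 * (‖k s‖ * ‖H s‖) * ‖X s‖ := by ring
      _ ≤ 2 * M * ‖X s‖ := by gcongr

end SolvesVonNeumann

/-- The trace as a continuous linear functional on operators. -/
noncomputable def traceCLM (E : Type*) [NormedAddCommGroup E] [InnerProductSpace ℂ E]
    [FiniteDimensional ℂ E] : (E →L[ℂ] E) →L[ℂ] ℂ :=
  LinearMap.toContinuousLinearMap
    ((LinearMap.trace ℂ E).comp (ContinuousLinearMap.coeLM ℂ))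

theorem traceCLM_apply (T : E →L[ℂ] E) : traceCLM E T = LinearMap.trace ℂ E (T : E →ₗ[ℂ] E) := rfl

theorem traceCLM_mul_comm (S T : E →L[ℂ] E) : traceCLM E (S * T) = traceCLM E (T * S) :=
  LinearMap.trace_mul_comm ℂ (S : E →ₗ[ℂ] E) (T : E →ₗ[ℂ] E)

theorem finite_real_spectrum (A : E →L[ℂ] E) : (spectrum ℝ A).Finite := by
  have : FiniteDimensional ℂ (E →L[ℂ] E) := inferInstance
  have : Module.Finite ℝ (E →L[ℂ] E) := Module.Finite.trans ℂ _
  have hint : IsIntegral ℝ A := IsIntegral.of_finite ℝ A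
  refine ((minpoly ℝ A).rootSet_finite ℝ).subset fun x hx => ?_
  rw [Polynomial.mem_rootSet]
  refine ⟨minpoly.ne_zero hint, ?_⟩
  have h := spectrum.subset_polynomial_aeval A (minpoly ℝ A) ⟨x, hx, rfl⟩
  rw [minpoly.aeval] at h
  by_contra h0
  exact h (by simpa [spectrum.mem_resolventSet_iff] using
    (isUnit_iff_ne_zero.mpr h0).map (algebraMap ℝ (E →L[ℂ] E)))

/-- The product of `X - x` over the spectrum annihilates `A`. -/
theorem exists_polynomial_aeval_eq_zero {A : E →L[ℂ] E} (hA : IsSelfAdjoint A) :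
    ∃ q : ℝ[X], Polynomial.aeval A q = 0 ∧ ∀ x, q.eval x = 0 → x ∈ spectrum ℝ A := by
  classical
  refine ⟨∏ x ∈ (finite_real_spectrum A).toFinset, (X - C x), ?_, fun x hx => ?_⟩
  · rw [← cfc_polynomial _ A hA, ← cfc_zero ℝ A]
    refine cfc_congr fun x hx => ?_
    rw [Polynomial.eval_prod]
    exact Finset.prod_eq_zero ((finite_real_spectrum A).mem_toFinset.mpr hx) (by simp)
  · rw [Polynomial.eval_prod, Finset.prod_eq_zero_iff] at hx
    obtain ⟨y, hy, hxy⟩ := hx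
    simp only [eval_sub, eval_X, eval_C, sub_eq_zero] at hxy
    rw [hxy]
    exact (finite_real_spectrum A).mem_toFinset.mp hy

theorem isPositive_iff_spectrum_nonneg {A : E →L[ℂ] E} (hA : IsSelfAdjoint A) :
    A.IsPositive ↔ ∀ x ∈ spectrum ℝ A, 0 ≤ x := by
  rw [← ContinuousLinearMap.nonneg_iff_isPositive,
    StarOrderedRing.nonneg_iff_spectrum_nonneg (R := ℝ) A hA]

/-- Density operators stay density operators. A polynomial relation satisfied initially is
satisfied at all times, so the spectrum of a solution never leaves its initial spectrum. -/
theorem SolvesVonNeumann.isDensity {H X : ℝ → E →L[ℂ] E} {k : ℝ → ℝ}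
    (hX : SolvesVonNeumann H k X) (hHsa : ∀ s ∈ Icc (0 : ℝ) 1, IsSelfAdjoint (H s))
    (hH : ContinuousOn H (Icc 0 1)) (hk : ContinuousOn k (Icc 0 1)) (h0 : IsDensity (X 0)) :
    ∀ s ∈ Icc (0 : ℝ) 1, IsDensity (X s) := by
  have hsa0 : IsSelfAdjoint (X 0) := h0.1.isSelfAdjoint
  have hsa : ∀ s ∈ Icc (0 : ℝ) 1, IsSelfAdjoint (X s) := fun s hs => by
    have := ((hX.star hHsa).sub hX).eq_zero hH hk (by simp [hsa0.star_eq]) s hs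
    exact sub_eq_zero.mp this
  obtain ⟨q, hq0, hq⟩ := exists_polynomial_aeval_eq_zero hsa0
  intro s hs
  refine ⟨(isPositive_iff_spectrum_nonneg (hsa s hs)).mpr fun x hx => ?_, ?_⟩
  · have h1 := (hX.aeval q).eq_zero hH hk hq0 s hs
    have h2 := spectrum.subset_polynomial_aeval (X s) q ⟨x, hx, rfl⟩
    simp only at h2
    rw [h1] at h2
    refine (isPositive_iff_spectrum_nonneg hsa0).mp h0.1 x (hq x ?_)
    by_contra hne
    exact h2 (by simpa [spectrum.mem_resolventSet_iff] using
      (isUnit_iff_ne_zero.mpr hne).map (algebraMap ℝ (E →L[ℂ] E)))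
  · have hder : ∀ t ∈ Icc (0 : ℝ) 1, HasDerivWithinAt (fun t => traceCLM E (X t)) 0 (Icc 0 1) t := by
      intro t ht
      refine (((traceCLM E).restrictScalars ℝ).hasFDerivAt.comp_hasDerivWithinAt t
        (hX t ht)).congr_deriv ?_
      simp [Ring.lie_def, traceCLM_mul_comm (H t) (X t)]
    have := constant_of_derivWithin_zero (fun t ht => (hder t ht).differentiableWithinAt)
      (fun t ht => (hder t (Ico_subset_Icc_self ht)).derivWithin
        (uniqueDiffOn_Icc zero_lt_one t (Ico_subset_Icc_self ht))) s hs
    exact this.trans h0.2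

/-- A density operator in an orthonormal eigenbasis: nonnegative weights of sum one. -/
theorem IsDensity.exists_eigenbasis {ρ : E →L[ℂ] E} (hρ : IsDensity ρ) :
    ∃ (b : OrthonormalBasis (Fin (Module.finrank ℂ E)) ℂ E) (p : Fin (Module.finrank ℂ E) → ℝ),
      (∀ i, 0 ≤ p i) ∧ ∑ i, p i = 1 ∧ (∀ i, ρ (b i) = (p i : ℂ) • b i) ∧
      ∀ T : E →L[ℂ] E, traceCLM E (T * ρ) = ∑ i, (p i : ℂ) * inner ℂ (b i) (T (b i)) := by
  have hsym : (ρ : E →ₗ[ℂ] E).IsSymmetric := hρ.1.1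
  set b := hsym.eigenvectorBasis rfl with hb
  have happ : ∀ i, ρ (b i) = (hsym.eigenvalues rfl i : ℂ) • b i :=
    fun i => hsym.apply_eigenvectorBasis rfl i
  have htr : ∀ T : E →L[ℂ] E, traceCLM E (T * ρ) =
      ∑ i, (hsym.eigenvalues rfl i : ℂ) * inner ℂ (b i) (T (b i)) := by
    intro T
    rw [traceCLM_apply, LinearMap.trace_eq_sum_inner _ b]
    refine Finset.sum_congr rfl fun i _ => ?_
    rw [ContinuousLinearMap.coe_coe, mul_apply_eq_comp, happ, map_smul, inner_smul_right]
  refine ⟨b, hsym.eigenvalues rfl, fun i => hρ.1.toLinearMap.nonneg_eigenvalues rfl i, ?_,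
    happ, htr⟩
  have h1 := htr 1
  rw [one_mul, traceCLM_apply, hρ.2] at h1
  have h2 : ∀ i, inner ℂ (b i) ((1 : E →L[ℂ] E) (b i)) = (1 : ℂ) := fun i => by simp
  simp only [h2, mul_one] at h1
  exact_mod_cast h1.symm

theorem IsDensity.norm_trace_mul_le {ρ : E →L[ℂ] E} (hρ : IsDensity ρ) (T : E →L[ℂ] E) :
    ‖traceCLM E (T * ρ)‖ ≤ ‖T‖ := by
  obtain ⟨b, p, hp0, hp1, -, htr⟩ := hρ.exists_eigenbasis
  rw [htr]
  calc ‖∑ i, (p i : ℂ) * inner ℂ (b i) (T (b i))‖ ≤ ∑ i, p i * ‖T‖ := by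
        refine norm_sum_le_of_le _ fun i _ => ?_
        rw [norm_mul, Complex.norm_real, Real.norm_of_nonneg (hp0 i)]
        refine mul_le_mul_of_nonneg_left ?_ (hp0 i)
        refine (norm_inner_le_norm _ _).trans ?_
        rw [b.orthonormal.1 i, one_mul]
        exact T.unit_le_opNorm _ (b.orthonormal.1 i).le
    _ = ‖T‖ := by rw [← Finset.sum_mul, hp1, one_mul]

/-- A density operator of full fidelity with a projector is supported on its range. -/
theorem IsDensity.proj_mul_eq {P ρ : E →L[ℂ] E} (hρ : IsDensity ρ) (hP : IsSelfAdjoint P)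
    (hPP : P * P = P) (h : fidelity P ρ = 1) : P * ρ = ρ := by
  obtain ⟨b, p, hp0, hp1, happ, htr⟩ := hρ.exists_eigenbasis
  have hinner : ∀ u v : E, inner ℂ (P u) v = inner ℂ u (P v) :=
    fun u v => (ContinuousLinearMap.isSelfAdjoint_iff_isSymmetric.mp hP) u v
  have hPPv : ∀ v, P (P v) = P v := fun v => by rw [← mul_apply_eq_comp, hPP]
  have hq : ∀ i, inner ℂ (b i) (P (b i)) = ((1 - ‖b i - P (b i)‖ ^ 2 : ℝ) : ℂ) := by
    intro i
    have h1 : inner ℂ (b i - P (b i)) (b i - P (b i)) = 1 - inner ℂ (b i) (P (b i)) := by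
      simp only [inner_sub_left, inner_sub_right, hinner, hPPv]
      simp
    rw [inner_self_eq_norm_sq_to_K] at h1
    push_cast
    rw [show ((‖b i - P (b i)‖ : ℂ)) ^ 2 = 1 - inner ℂ (b i) (P (b i)) from h1]
    ring
  have h1 : ∑ i, p i * ‖b i - P (b i)‖ ^ 2 = 0 := by
    have h2 : fidelity P ρ = (traceCLM E (P * ρ)).re := rfl
    rw [h2, htr] at h
    simp only [hq] at h
    have h3 : ∑ i, p i * (1 - ‖b i - P (b i)‖ ^ 2) = 1 := by
      have h4 := h.symm
      norm_cast at h4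
      exact h4.symm
    simp only [mul_sub, mul_one, Finset.sum_sub_distrib, hp1] at h3
    linarith
  have h2 := (Finset.sum_eq_zero_iff_of_nonneg (fun i _ => mul_nonneg (hp0 i) (by positivity))).mp h1
  refine ContinuousLinearMap.coe_injective (b.toBasis.ext fun i => ?_)
  simp only [OrthonormalBasis.coe_toBasis, ContinuousLinearMap.coe_coe, mul_apply_eq_comp, happ,
    map_smul]
  rcases mul_eq_zero.mp (h2 i (Finset.mem_univ i)) with h3 | h3
  · simp [h3]
  · rw [← sub_eq_zero.mp (norm_eq_zero.mp (pow_eq_zero_iff two_ne_zero |>.mp h3))]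

end Adiabatic

/-! ### Error bound for a general schedule -/

namespace Adiabatic

/-- Absolute continuity passes to any function whose increments are dominated by those of an
absolutely continuous one; this covers Lipschitz images as well as changes off the interval. -/
theorem absolutelyContinuousOnInterval_of_dist_le {f g : ℝ → ℝ} {a b L : ℝ} (hL : 0 ≤ L)
    (hf : AbsolutelyContinuousOnInterval f a b)
    (h : ∀ x ∈ uIcc a b, ∀ y ∈ uIcc a b, dist (g x) (g y) ≤ L * dist (f x) (f y)) :
    AbsolutelyContinuousOnInterval g a b := by
  rw [absolutelyContinuousOnInterval_iff] at hf ⊢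
  intro ε hε
  obtain ⟨δ, hδ, hd⟩ := hf (ε / (L + 1)) (by positivity)
  refine ⟨δ, hδ, fun I hI hI' => ?_⟩
  have h1 := hd I hI hI'
  calc ∑ i ∈ Finset.range I.1, dist (g (I.2 i).1) (g (I.2 i).2)
      ≤ ∑ i ∈ Finset.range I.1, (L + 1) * dist (f (I.2 i).1) (f (I.2 i).2) := by
        refine Finset.sum_le_sum fun i hi => ?_
        have hm := hI.1 i hi
        refine (h _ hm.1 _ hm.2).trans ?_
        gcongr
        linarith
    _ = (L + 1) * ∑ i ∈ Finset.range I.1, dist (f (I.2 i).1) (f (I.2 i).2) := by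
        rw [Finset.mul_sum]
    _ < (L + 1) * (ε / (L + 1)) := by gcongr
    _ = ε := by field_simp

theorem restrict_Icc_eq_restrict_Ioo :
    (volume.restrict (Icc (0 : ℝ) 1)) = volume.restrict (Ioo (0 : ℝ) 1) :=
  Measure.restrict_congr_set Ioo_ae_eq_Icc.symm

theorem intervalIntegral_eq_restrict_Ioo (f : ℝ → ℝ) :
    ∫ s in (0 : ℝ)..1, f s = ∫ s in Ioo (0 : ℝ) 1, f s := by
  rw [intervalIntegral.integral_of_le zero_le_one, Measure.restrict_congr_set Ioo_ae_eq_Ioc]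

theorem intervalIntegrable_iff_restrict_Ioo {f : ℝ → ℝ} :
    IntervalIntegrable f volume 0 1 ↔ Integrable f (volume.restrict (Ioo (0 : ℝ) 1)) := by
  rw [intervalIntegrable_iff_integrableOn_Ioo_of_le zero_le_one, IntegrableOn]

theorem hasDerivAt_of_Icc {f : ℝ → ℝ} {f' s : ℝ} (h : HasDerivWithinAt f f' (Icc 0 1) s)
    (hs : s ∈ Ioo (0 : ℝ) 1) : HasDerivAt f f' s :=
  h.hasDerivAt (Icc_mem_nhds hs.1 hs.2)

/-- A function differentiable on `[0, 1]` with integrable derivative is absolutely continuous. -/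
theorem absolutelyContinuousOnInterval_of_hasDerivWithinAt {f f' : ℝ → ℝ}
    (h : ∀ s ∈ Icc (0 : ℝ) 1, HasDerivWithinAt f (f' s) (Icc 0 1) s)
    (hi : IntervalIntegrable f' volume 0 1) : AbsolutelyContinuousOnInterval f 0 1 := by
  have hu : uIcc (0 : ℝ) 1 = Icc 0 1 := uIcc_of_le zero_le_one
  have key : ∀ x ∈ Icc (0 : ℝ) 1, ∫ t in (0 : ℝ)..x, f' t = f x - f 0 := by
    intro x hx
    refine intervalIntegral.integral_eq_sub_of_hasDerivAt_of_le hx.1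
      (fun t ht => (h t ⟨ht.1, ht.2.trans hx.2⟩).continuousWithinAt.mono
        (Icc_subset_Icc_right hx.2))
      (fun t ht => hasDerivAt_of_Icc (h t ⟨ht.1.le, ht.2.le.trans hx.2⟩)
        ⟨ht.1, ht.2.trans_le hx.2⟩) (hi.mono_set ?_)
    rw [hu, uIcc_of_le hx.1]
    exact Icc_subset_Icc_right hx.2
  refine absolutelyContinuousOnInterval_of_dist_le zero_le_one
    (hi.absolutelyContinuousOnInterval_intervalIntegral (c := 0) (by simp)) ?_
  rw [hu]
  intro x hx y hy
  rw [key x hx, key y hy, dist_sub_right, one_mul]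

/-- Integration by parts in the form used for the adiabatic estimate: `F' + u r = u v'` with
`v 0 = 0`, where `r` and `v` are known only through upper bounds `c` and `w`. -/
theorem ofReal_sub_le_of_mul_deriv {u k F F' v r c w : ℝ → ℝ}
    (hu : AbsolutelyContinuousOnInterval u 0 1) (hk : ContinuousOn k (Icc 0 1))
    (hupos : ∀ s ∈ Icc (0 : ℝ) 1, 0 < u s) (huk : ∀ s ∈ Icc (0 : ℝ) 1, u s * k s = 1)
    (hF : ∀ s ∈ Icc (0 : ℝ) 1, HasDerivWithinAt F (F' s) (Icc 0 1) s)
    (hF' : ContinuousOn F' (Icc 0 1))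
    (hv : ∀ s ∈ Icc (0 : ℝ) 1, HasDerivWithinAt v (k s * F' s + r s) (Icc 0 1) s)
    (hv0 : v 0 = 0) (hr : ∀ s ∈ Icc (0 : ℝ) 1, |r s| ≤ c s)
    (hw : ∀ s ∈ Icc (0 : ℝ) 1, |v s| ≤ w s) :
    ENNReal.ofReal (F 0 - F 1) ≤ ENNReal.ofReal (u 1 * w 1) +
      (∫⁻ s in Icc (0 : ℝ) 1, ENNReal.ofReal (u s * c s)) +
      ∫⁻ s in Icc (0 : ℝ) 1, ENNReal.ofReal (|derivWithin u (Icc 0 1) s| * w s) := by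
  -- The derivative of `v` need not be integrable, but then the right-hand side is infinite.
  rcases eq_or_ne (∫⁻ s in Icc (0 : ℝ) 1, ENNReal.ofReal (u s * c s)) ⊤ with htop | htop
  · rw [htop]; simp
  rw [restrict_Icc_eq_restrict_Ioo] at htop ⊢
  have hmem : ∀ᵐ s ∂(volume.restrict (Ioo (0 : ℝ) 1)), s ∈ Ioo (0 : ℝ) 1 :=
    ae_restrict_mem measurableSet_Ioo
  have hsub : Ioo (0 : ℝ) 1 ⊆ Icc 0 1 := Ioo_subset_Icc_self
  have hI : uIcc (0 : ℝ) 1 = Icc 0 1 := uIcc_of_le zero_le_one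
  have hkF : ContinuousOn (fun s => k s * F' s) (Icc 0 1) := hk.mul hF'
  -- `r` is measurable since it is the derivative of `v` up to a continuous function.
  have hrm : AEStronglyMeasurable r (volume.restrict (Ioo (0 : ℝ) 1)) := by
    have h1 : AEStronglyMeasurable (fun s => deriv v s - k s * F' s)
        (volume.restrict (Ioo (0 : ℝ) 1)) :=
      (measurable_deriv v).aestronglyMeasurable.sub
        ((hkF.mono hsub).aestronglyMeasurable measurableSet_Ioo)
    refine h1.congr (hmem.mono fun s hs => ?_)
    simp only [(hasDerivAt_of_Icc (hv s (hsub hs)) hs).deriv, add_sub_cancel_left]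
  obtain ⟨M, hM⟩ := isCompact_Icc.exists_bound_of_continuousOn hk
  have hri : Integrable r (volume.restrict (Ioo (0 : ℝ) 1)) := by
    refine ⟨hrm, ?_⟩
    have h1 : ∫⁻ s in Ioo (0 : ℝ) 1, ‖r s‖ₑ ≤
        ∫⁻ s in Ioo (0 : ℝ) 1, ENNReal.ofReal M * ENNReal.ofReal (u s * c s) := by
      refine lintegral_mono_ae (hmem.mono fun s hs => ?_)
      have hs' := hsub hs
      have hkpos : 0 < k s := pos_of_mul_pos_right ((huk s hs').symm ▸ one_pos) (hupos s hs').le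
      have hkM : k s ≤ M := (le_abs_self _).trans (hM s hs')
      have hc : 0 ≤ c s := (abs_nonneg _).trans (hr s hs')
      rw [← ENNReal.ofReal_mul (hkpos.le.trans hkM), Real.enorm_eq_ofReal_abs]
      refine ENNReal.ofReal_le_ofReal ((hr s hs').trans ?_)
      calc c s = k s * (u s * c s) := by rw [← mul_assoc, mul_comm (k s), huk s hs', one_mul]
        _ ≤ M * (u s * c s) := by
          have := (hupos s hs').le
          gcongr
    refine h1.trans_lt ?_
    rw [lintegral_const_mul' _ _ ENNReal.ofReal_ne_top]
    exact ENNReal.mul_lt_top ENNReal.ofReal_lt_top htop.lt_top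
  have hFi : IntervalIntegrable F' volume 0 1 := (hI ▸ hF').intervalIntegrable
  have hkFi : IntervalIntegrable (fun s => k s * F' s) volume 0 1 := (hI ▸ hkF).intervalIntegrable
  have hri' : IntervalIntegrable r volume 0 1 := intervalIntegrable_iff_restrict_Ioo.mpr hri
  have hvac : AbsolutelyContinuousOnInterval v 0 1 :=
    absolutelyContinuousOnInterval_of_hasDerivWithinAt hv (hkFi.add hri')
  have hparts := hu.integral_mul_deriv_eq_deriv_mul hvac
  have huri : IntervalIntegrable (fun s => u s * r s) volume 0 1 :=
    hri'.continuousOn_mul hu.continuousOn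
  have hlhs : ∫ s in (0 : ℝ)..1, u s * deriv v s =
      (∫ s in (0 : ℝ)..1, F' s) + ∫ s in (0 : ℝ)..1, u s * r s := by
    rw [← intervalIntegral.integral_add hFi huri, intervalIntegral_eq_restrict_Ioo,
      intervalIntegral_eq_restrict_Ioo]
    refine integral_congr_ae (hmem.mono fun s hs => ?_)
    simp only [(hasDerivAt_of_Icc (hv s (hsub hs)) hs).deriv]
    rw [mul_add, ← mul_assoc, huk s (hsub hs), one_mul]
  have hFTC : ∫ s in (0 : ℝ)..1, F' s = F 1 - F 0 :=
    intervalIntegral.integral_eq_sub_of_hasDerivAt_of_le zero_le_one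
      (fun s hs => (hF s hs).continuousWithinAt)
      (fun s hs => hasDerivAt_of_Icc (hF s (hsub hs)) hs) hFi
  rw [hlhs, hFTC, hv0, mul_zero, sub_zero, intervalIntegral_eq_restrict_Ioo,
    intervalIntegral_eq_restrict_Ioo] at hparts
  have h01 : (1 : ℝ) ∈ Icc (0 : ℝ) 1 := ⟨zero_le_one, le_rfl⟩
  have hle : F 0 - F 1 ≤ u 1 * w 1 + |∫ s in Ioo (0 : ℝ) 1, u s * r s| +
      |∫ s in Ioo (0 : ℝ) 1, deriv u s * v s| := by
    have h1 : -(u 1 * v 1) ≤ u 1 * w 1 := by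
      rw [← mul_neg]
      exact mul_le_mul_of_nonneg_left ((neg_le_abs _).trans (hw 1 h01)) (hupos 1 h01).le
    have h2 := le_abs_self (∫ s in Ioo (0 : ℝ) 1, u s * r s)
    have h3 := le_abs_self (∫ s in Ioo (0 : ℝ) 1, deriv u s * v s)
    linarith
  refine (ENNReal.ofReal_le_ofReal hle).trans (ENNReal.ofReal_add_le.trans
    (add_le_add (ENNReal.ofReal_add_le.trans (add_le_add le_rfl ?_)) ?_))
  · rw [← Real.enorm_eq_ofReal_abs]
    refine (enorm_integral_le_lintegral_enorm _).trans (lintegral_mono_ae (hmem.mono fun s hs => ?_))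
    rw [Real.enorm_eq_ofReal_abs, abs_mul, abs_of_pos (hupos s (hsub hs))]
    exact ENNReal.ofReal_le_ofReal
      (mul_le_mul_of_nonneg_left (hr s (hsub hs)) (hupos s (hsub hs)).le)
  · rw [← Real.enorm_eq_ofReal_abs]
    refine (enorm_integral_le_lintegral_enorm _).trans (lintegral_mono_ae (hmem.mono fun s hs => ?_))
    rw [Real.enorm_eq_ofReal_abs, abs_mul, derivWithin_of_mem_nhds (Icc_mem_nhds hs.1 hs.2)]
    exact ENNReal.ofReal_le_ofReal
      (mul_le_mul_of_nonneg_left (hw s (hsub hs)) (abs_nonneg _))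

variable {E : Type*} [NormedAddCommGroup E] [InnerProductSpace ℂ E] [FiniteDimensional ℂ E]
  [CompleteSpace E]

theorem absolutelyContinuousOnInterval_inv {k : ℝ → ℝ}
    (hk : AbsolutelyContinuousOnInterval k 0 1) (hpos : ∀ s ∈ Icc (0 : ℝ) 1, 0 < k s) :
    AbsolutelyContinuousOnInterval (fun s => (k s)⁻¹) 0 1 := by
  have hI : uIcc (0 : ℝ) 1 = Icc 0 1 := uIcc_of_le zero_le_one
  have hc : ContinuousOn k (Icc 0 1) := hI ▸ hk.continuousOn
  obtain ⟨M, hM⟩ := isCompact_Icc.exists_bound_of_continuousOn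
    (hc.inv₀ fun s hs => (hpos s hs).ne')
  refine absolutelyContinuousOnInterval_of_dist_le (L := M * M) (mul_self_nonneg M) hk ?_
  rw [hI]
  intro x hx y hy
  have h1 := hM x hx
  have h2 := hM y hy
  have hx0 := (hpos x hx).ne'
  have hy0 := (hpos y hy).ne'
  rw [Real.dist_eq, Real.dist_eq, inv_sub_inv hx0 hy0, abs_div, abs_sub_comm, div_eq_inv_mul,
    ← abs_inv, mul_inv, abs_mul]
  gcongr
  · exact (norm_nonneg _).trans h1
  · exact h1
  · exact h2

theorem hasDerivWithinAt_clm_comp {f : (E →L[ℂ] E) →L[ℝ] ℝ} {X : ℝ → E →L[ℂ] E}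
    {X' : E →L[ℂ] E} {s : ℝ} (h : HasDerivWithinAt X X' (Icc 0 1) s) :
    HasDerivWithinAt (fun t => f (X t)) (f X') (Icc 0 1) s :=
  f.hasFDerivAt.comp_hasDerivWithinAt s h

theorem trace_mul_lie (X Y Z : E →L[ℂ] E) :
    traceCLM E (X * ⁅Y, Z⁆) = traceCLM E (⁅X, Y⁆ * Z) := by
  rw [Ring.lie_def, Ring.lie_def, mul_sub, sub_mul, map_sub, map_sub, ← mul_assoc, ← mul_assoc,
    traceCLM_mul_comm (X * Z), mul_assoc Y X Z]

namespace IsGappedPath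

variable {H H₁ H₂ : ℝ → E →L[ℂ] E} {lam g₀ : ℝ → ℝ} {k : ℝ → ℝ} {ρ : ℝ → E →L[ℂ] E}

theorem continuousOn_H (hH : IsGappedPath H H₁ H₂ lam g₀) : ContinuousOn H (Icc 0 1) :=
  fun s hs => (hH.hasDeriv s hs).continuousWithinAt

theorem isDensity_of_isEvolution (hH : IsGappedPath H H₁ H₂ lam g₀)
    (hk : ContinuousOn k (Icc 0 1)) (hρ : IsEvolution H lam k ρ) :
    ∀ s ∈ Icc (0 : ℝ) 1, IsDensity (ρ s) :=
  SolvesVonNeumann.isDensity hρ.hasDeriv hH.selfAdjoint hH.continuousOn_H hk hρ.density_zero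

/-- The rate of change of the fidelity comes from the motion of the projector alone. -/
theorem hasDerivWithinAt_fidelity (hH : IsGappedPath H H₁ H₂ lam g₀)
    (hg : ContinuousOn g₀ (Icc 0 1)) (hρ : IsEvolution H lam k ρ) {s : ℝ}
    (hs : s ∈ Icc (0 : ℝ) 1) :
    HasDerivWithinAt (fun t => fidelity (eigenProj (H t) (lam t)) (ρ t))
      (traceCLM E (⁅gapCommutator H lam s, H s⁆ * ρ s)).re (Icc 0 1) s := by
  have hP := hH.hasDerivWithinAt_proj hg hs
  rw [← hH.derivWithin_proj hg hs, hH.derivWithin_proj_eq_lie hg hs] at hP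
  refine (hasDerivWithinAt_clm_comp
    (f := Complex.reCLM.comp ((traceCLM E).restrictScalars ℝ))
    (hP.fun_mul (hρ.hasDeriv s hs))).congr_deriv ?_
  have h0 : ⁅proj H lam s, H s⁆ = 0 := by rw [Ring.lie_def, hH.commute_proj hs, sub_self]
  simp only [ContinuousLinearMap.comp_apply, ContinuousLinearMap.coe_restrictScalars',
    Complex.reCLM_apply, map_add, mul_smul_comm, map_smul, trace_mul_lie, h0, zero_mul, map_zero,
    smul_zero, add_zero]

theorem hasDerivWithinAt_trace_gapCommutator_mul (hH : IsGappedPath H H₁ H₂ lam g₀)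
    (hg : ContinuousOn g₀ (Icc 0 1)) (hρ : IsEvolution H lam k ρ) {s : ℝ}
    (hs : s ∈ Icc (0 : ℝ) 1) :
    HasDerivWithinAt (fun t => -(traceCLM E (gapCommutator H lam t * ρ t)).im)
      (k s * (traceCLM E (⁅gapCommutator H lam s, H s⁆ * ρ s)).re +
        -(traceCLM E (derivWithin (gapCommutator H lam) (Icc 0 1) s * ρ s)).im) (Icc 0 1) s := by
  have hC := (hH.differentiableOn_gapCommutator hg s hs).hasDerivWithinAt
  refine (hasDerivWithinAt_clm_comp
    (f := -Complex.imCLM.comp ((traceCLM E).restrictScalars ℝ))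
    (hC.fun_mul (hρ.hasDeriv s hs))).congr_deriv ?_
  simp only [neg_apply, ContinuousLinearMap.comp_apply,
    ContinuousLinearMap.coe_restrictScalars', Complex.imCLM_apply, map_add, mul_smul_comm, map_smul,
    trace_mul_lie, smul_eq_mul, Complex.mul_im, Complex.neg_re, Complex.neg_im,
    Complex.I_re, Complex.I_im, Complex.mul_re, Complex.ofReal_re, Complex.ofReal_im]
  ring

/-- The boundary term at the initial time vanishes: `ρ(0) = P ρ(0) P`, and the commutator is
off-diagonal, `P C P = 0`. -/
theorem trace_gapCommutator_mul_zero (hH : IsGappedPath H H₁ H₂ lam g₀)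
    (hg : ContinuousOn g₀ (Icc 0 1)) (hρ : IsEvolution H lam k ρ) :
    traceCLM E (gapCommutator H lam 0 * ρ 0) = 0 := by
  have hs : (0 : ℝ) ∈ Icc (0 : ℝ) 1 := ⟨le_rfl, zero_le_one⟩
  have r := hH.isReduced 0 hs
  have h1 : proj H lam 0 * ρ 0 = ρ 0 :=
    hρ.density_zero.proj_mul_eq r.selfAdjoint_proj r.proj_mul_self hρ.fidelity_zero
  have h2 : ρ 0 * proj H lam 0 = ρ 0 := by
    have := congrArg star h1
    rwa [star_mul, r.selfAdjoint_proj.star_eq, hρ.density_zero.1.isSelfAdjoint.star_eq] at this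
  have h3 : proj H lam 0 * gapCommutator H lam 0 * proj H lam 0 = 0 := by
    have e1 : proj H lam 0 * offBlock H H₁ lam 0 = 0 := by
      simp only [offBlock, ← mul_assoc, r.proj_mul_pinv, zero_mul]
    have e2 : star (offBlock H H₁ lam 0) * proj H lam 0 = 0 := by
      have := congrArg star e1
      rwa [star_mul, r.selfAdjoint_proj.star_eq, star_zero] at this
    rw [hH.gapCommutator_eq hg hs, mul_sub, sub_mul, e1, mul_assoc, e2]
    simp
  rw [← h2, ← mul_assoc, traceCLM_mul_comm, ← h1, ← mul_assoc, ← mul_assoc, h3, zero_mul, map_zero]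

theorem continuousOn_trace_lie_mul (hH : IsGappedPath H H₁ H₂ lam g₀)
    (hg : ContinuousOn g₀ (Icc 0 1)) (hρ : IsEvolution H lam k ρ) :
    ContinuousOn (fun s => (traceCLM E (⁅gapCommutator H lam s, H s⁆ * ρ s)).re) (Icc 0 1) := by
  have hC := (hH.differentiableOn_gapCommutator hg).continuousOn
  have hHc := hH.continuousOn_H
  have hρc : ContinuousOn ρ (Icc 0 1) := fun s hs => (hρ.hasDeriv s hs).continuousWithinAt
  refine Complex.continuous_re.comp_continuousOn ((traceCLM E).continuous.comp_continuousOn ?_)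
  simp only [Ring.lie_def]
  exact ((hC.mul hHc).sub (hHc.mul hC)).mul hρc

theorem one_sub_fidelity_le (hH : IsGappedPath H H₁ H₂ lam g₀)
    (hg : ContinuousOn g₀ (Icc 0 1)) (hkpos : ∀ s ∈ Icc (0 : ℝ) 1, 0 < k s)
    (hk : AbsolutelyContinuousOnInterval k 0 1) (hρ : IsEvolution H lam k ρ) :
    ENNReal.ofReal (1 - fidelity (eigenProj (H 1) (lam 1)) (ρ 1)) ≤
      ENNReal.ofReal ((k 1)⁻¹ * ‖gapCommutator H lam 1‖) +
      (∫⁻ s in Icc (0 : ℝ) 1,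
        ENNReal.ofReal ((k s)⁻¹ * ‖derivWithin (gapCommutator H lam) (Icc 0 1) s‖)) +
      ∫⁻ s in Icc (0 : ℝ) 1,
        ENNReal.ofReal (|derivWithin (fun t => (k t)⁻¹) (Icc 0 1) s| *
          ‖gapCommutator H lam s‖) := by
  have hkc : ContinuousOn k (Icc 0 1) := by
    simpa only [uIcc_of_le (zero_le_one (α := ℝ))] using hk.continuousOn
  have hd := hH.isDensity_of_isEvolution hkc hρ
  have h := ofReal_sub_le_of_mul_deriv (u := fun s => (k s)⁻¹)
    (F := fun t => fidelity (eigenProj (H t) (lam t)) (ρ t))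
    (c := fun s => ‖derivWithin (gapCommutator H lam) (Icc 0 1) s‖)
    (w := fun s => ‖gapCommutator H lam s‖)
    (absolutelyContinuousOnInterval_inv hk hkpos) hkc
    (fun s hs => inv_pos.mpr (hkpos s hs)) (fun s hs => inv_mul_cancel₀ (hkpos s hs).ne')
    (fun s hs => hH.hasDerivWithinAt_fidelity hg hρ hs) (hH.continuousOn_trace_lie_mul hg hρ)
    (fun s hs => hH.hasDerivWithinAt_trace_gapCommutator_mul hg hρ hs)
    (by simp [hH.trace_gapCommutator_mul_zero hg hρ])
    (fun s hs => (abs_neg _).trans_le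
      ((Complex.abs_im_le_norm _).trans ((hd s hs).norm_trace_mul_le _)))
    (fun s hs => (abs_neg _).trans_le
      ((Complex.abs_im_le_norm _).trans ((hd s hs).norm_trace_mul_le _)))
  rwa [hρ.fidelity_zero] at h

end IsGappedPath
end Adiabatic

/-! ### The gap-adapted schedule -/

namespace Adiabatic

theorem le_of_ae_le_of_continuousOn {f : ℝ → ℝ} {c : ℝ} (hf : ContinuousOn f (Icc 0 1))
    (h : ∀ᵐ s ∂(volume.restrict (Icc (0 : ℝ) 1)), f s ≤ c) : ∀ s ∈ Icc (0 : ℝ) 1, f s ≤ c := by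
  have h1 : (fun s => max (f s) c) =ᵐ[volume.restrict (Icc (0 : ℝ) 1)] fun _ => c :=
    h.mono fun s hs => max_eq_right hs
  intro s hs
  exact max_eq_right_iff.mp (Measure.eqOn_Icc_of_ae_eq volume zero_ne_one h1
    (hf.sup continuousOn_const) continuousOn_const hs)

theorem absolutelyContinuousOnInterval_rpow {g : ℝ → ℝ}
    (hg : AbsolutelyContinuousOnInterval g 0 1) (hpos : ∀ s ∈ Icc (0 : ℝ) 1, 0 < g s) (p : ℝ) :
    AbsolutelyContinuousOnInterval (fun s => g s ^ p) 0 1 := by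
  have hI : uIcc (0 : ℝ) 1 = Icc 0 1 := uIcc_of_le zero_le_one
  have hc : ContinuousOn g (Icc 0 1) := hI ▸ hg.continuousOn
  have hne : (Icc (0 : ℝ) 1).Nonempty := nonempty_Icc.mpr zero_le_one
  obtain ⟨a, ha, hmin⟩ := isCompact_Icc.exists_isMinOn hne hc
  obtain ⟨b, hb, hmax⟩ := isCompact_Icc.exists_isMaxOn hne hc
  have hcd : ContDiffOn ℝ 1 (fun x : ℝ => x ^ p) (Icc (g a) (g b)) := fun x hx =>
    (Real.contDiffAt_rpow_const_of_ne ((hpos a ha).trans_le hx.1).ne').contDiffWithinAt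
  obtain ⟨L, hL⟩ := hcd.exists_lipschitzOnWith (by decide) (convex_Icc _ _) isCompact_Icc
  refine absolutelyContinuousOnInterval_of_dist_le L.2 hg ?_
  rw [hI]
  exact fun x hx y hy => hL.dist_le_mul _ ⟨hmin hx, hmax hx⟩ _ ⟨hmin hy, hmax hy⟩

section Powers

variable {g m p : ℝ}

theorem rpow_mul_rpow_mul_le_one (hg : 0 < g) (hm : 0 < m) (hp1 : 1 ≤ p) (hp2 : p ≤ 2) :
    g ^ p * m ^ (2 - p) * (max g m)⁻¹ ^ 2 ≤ 1 := by
  have hM : 0 < max g m := lt_max_of_lt_left hg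
  have h1 : g ^ p ≤ max g m ^ p := Real.rpow_le_rpow hg.le (le_max_left _ _) (by linarith)
  have h2 : m ^ (2 - p) ≤ max g m ^ (2 - p) :=
    Real.rpow_le_rpow hm.le (le_max_right _ _) (by linarith)
  have h3 : max g m ^ p * max g m ^ (2 - p) = max g m ^ 2 := by
    rw [← Real.rpow_add hM, ← Real.rpow_natCast]; congr 1; push_cast; ring
  rw [inv_pow, ← div_eq_mul_inv, div_le_one (by positivity), ← h3]
  gcongr

theorem rpow_mul_inv_max_pow_le (hg : 0 < g) (q : ℝ) (n : ℕ) :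
    g ^ q * (max g m)⁻¹ ^ n ≤ g ^ (q - n) := by
  rw [Real.rpow_sub hg, Real.rpow_natCast, div_eq_mul_inv, ← inv_pow]
  have := le_max_left g m
  gcongr

end Powers

variable {E : Type*} [NormedAddCommGroup E] [InnerProductSpace ℂ E] [FiniteDimensional ℂ E]
  [CompleteSpace E]

namespace IsGappedPath

variable {H H₁ H₂ : ℝ → E →L[ℂ] E} {lam g₀ : ℝ → ℝ} {k : ℝ → ℝ} {ρ : ℝ → E →L[ℂ] E}

/-- For a constant Hamiltonian the fidelity is conserved, whatever the schedule. -/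
theorem fidelity_eq_one_of_H₁_eq_zero (hH : IsGappedPath H H₁ H₂ lam g₀)
    (hg : ContinuousOn g₀ (Icc 0 1)) (h0 : ∀ s ∈ Icc (0 : ℝ) 1, H₁ s = 0)
    (hρ : IsEvolution H lam k ρ) : fidelity (eigenProj (H 1) (lam 1)) (ρ 1) = 1 := by
  have hd : ∀ s ∈ Icc (0 : ℝ) 1,
      HasDerivWithinAt (fun t => fidelity (eigenProj (H t) (lam t)) (ρ t)) 0 (Icc 0 1) s := by
    intro s hs
    refine (hH.hasDerivWithinAt_fidelity hg hρ hs).congr_deriv ?_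
    rw [← hH.derivWithin_proj_eq_lie hg hs, hH.derivWithin_proj hg hs, h0 s hs]
    simp
  have := constant_of_derivWithin_zero (fun t ht => (hd t ht).differentiableWithinAt)
    (fun t ht => (hd t (Ico_subset_Icc_self ht)).derivWithin
      (uniqueDiffOn_Icc zero_lt_one t (Ico_subset_Icc_self ht))) 1 ⟨zero_le_one, le_rfl⟩
  exact this.trans hρ.fidelity_zero

variable {p B₁ B₂ gmin c ε : ℝ}

theorem continuousOn_gap_rpow (hH : IsGappedPath H H₁ H₂ lam g₀)
    (hg : ContinuousOn g₀ (Icc 0 1)) (q : ℝ) : ContinuousOn (fun s => g₀ s ^ q) (Icc 0 1) :=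
  hg.rpow_const fun s hs => Or.inl (hH.gap_pos s hs).ne'

theorem continuousOn_schedule (hH : IsGappedPath H H₁ H₂ lam g₀)
    (hg : ContinuousOn g₀ (Icc 0 1)) (hε : 0 < ε) (hm : 0 < gmin) :
    ContinuousOn (fun s => c / (ε * g₀ s ^ p * gmin ^ (2 - p))) (Icc 0 1) := by
  refine continuousOn_const.div (((continuousOn_const.mul (hH.continuousOn_gap_rpow hg p))).mul
    continuousOn_const) fun s hs => ?_
  have := hH.gap_pos s hs
  positivity

theorem integral_schedule_le (hH : IsGappedPath H H₁ H₂ lam g₀)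
    (hε : 0 < ε) (hm : 0 < gmin) (hc : 0 ≤ c)
    (hB₁ : (∫ s in (0 : ℝ)..1, g₀ s ^ (-p)) ≤ B₁ * gmin ^ (1 - p)) :
    (∫ s in (0 : ℝ)..1, c / (ε * g₀ s ^ p * gmin ^ (2 - p))) ≤ c * B₁ / (ε * gmin) := by
  have e : ∫ s in (0 : ℝ)..1, c / (ε * g₀ s ^ p * gmin ^ (2 - p)) =
      c / (ε * gmin ^ (2 - p)) * ∫ s in (0 : ℝ)..1, g₀ s ^ (-p) := by
    rw [← intervalIntegral.integral_const_mul]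
    refine intervalIntegral.integral_congr fun s hs => ?_
    rw [uIcc_of_le zero_le_one] at hs
    have := hH.gap_pos s hs
    simp only [Real.rpow_neg this.le]
    field_simp
  rw [e]
  refine (mul_le_mul_of_nonneg_left hB₁ (by positivity)).trans_eq ?_
  have h2 : gmin ^ (2 - p) = gmin ^ (1 - p) * gmin := by
    rw [show (2 - p) = (1 - p) + 1 by ring, Real.rpow_add_one hm.ne']
  rw [h2]
  have : 0 < gmin ^ (1 - p) := by positivity
  field_simp

/-- The weight `g₀ᵖ⁻³ gmin²⁻ᵖ`, which bounds the factor of `‖H'‖²` and of `|g₀'| ‖H'‖` in the error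
integrals, has total mass at most `B₂`. -/
theorem weight_bounds (hH : IsGappedPath H H₁ H₂ lam g₀)
    (hg : ContinuousOn g₀ (Icc 0 1)) (hm : 0 < gmin)
    (hB₂ : (∫ s in (0 : ℝ)..1, g₀ s ^ (p - 3)) ≤ B₂ * gmin ^ (p - 2)) :
    0 < B₂ ∧ IntegrableOn (fun s => g₀ s ^ (p - 3) * gmin ^ (2 - p)) (Icc 0 1) ∧
      ∫ s in Icc (0 : ℝ) 1, g₀ s ^ (p - 3) * gmin ^ (2 - p) ≤ B₂ := by
  have hc := hH.continuousOn_gap_rpow hg (p - 3)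
  have hI : uIcc (0 : ℝ) 1 = Icc 0 1 := uIcc_of_le zero_le_one
  have hpos : 0 < ∫ s in (0 : ℝ)..1, g₀ s ^ (p - 3) := by
    refine intervalIntegral.intervalIntegral_pos_of_pos_on (hI ▸ hc).intervalIntegrable
      (fun s hs => ?_) zero_lt_one
    have := hH.gap_pos s (Ioo_subset_Icc_self hs)
    positivity
  have hm' : 0 < gmin ^ (p - 2) := by positivity
  refine ⟨pos_of_mul_pos_left (hpos.trans_le hB₂) hm'.le,
    (hc.mul continuousOn_const).integrableOn_Icc, ?_⟩
  rw [integral_Icc_eq_integral_Ioc, ← intervalIntegral.integral_of_le zero_le_one,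
    intervalIntegral.integral_mul_const]
  refine (mul_le_mul_of_nonneg_right hB₂ (by positivity)).trans_eq ?_
  rw [mul_assoc, ← Real.rpow_add hm]
  simp

/-- The three error terms for the gap-adapted schedule, relative to `ε`: the boundary term is at
most `1/4`, the term with the derivative of the commutator at most `1/5 + 1/4`, and the term with
the derivative of the schedule at most `1/6`. -/
theorem one_sub_le_fidelity_of_pos (hH : IsGappedPath H H₁ H₂ lam g₀)
    (hg : AbsolutelyContinuousOnInterval g₀ 0 1) (hp1 : 1 ≤ p) (hp2 : p ≤ 2) (hε : 0 < ε)
    (hm : 0 < gmin)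
    (hgap : ∀ s ∈ Icc (0 : ℝ) 1, ENNReal.ofReal gmin ≤ spectralGap (H s) (lam s))
    (hB₂ : (∫ s in (0 : ℝ)..1, g₀ s ^ (p - 3)) ≤ B₂ * gmin ^ (p - 2))
    (hc : ∀ᵐ s ∂(volume.restrict (Icc (0 : ℝ) 1)),
      4 * ‖H₁ s‖ + 40 * ‖H₁ s‖ ^ 2 * B₂ + 4 * ‖H₂ s‖ +
        6 * p * |derivWithin g₀ (Icc 0 1) s| * ‖H₁ s‖ * B₂ ≤ c) (hc0 : 0 < c)
    (hc1 : 4 * ‖H₁ 1‖ ≤ c)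
    (hρ : IsEvolution H lam (fun s => c / (ε * g₀ s ^ p * gmin ^ (2 - p))) ρ) :
    1 - ε ≤ fidelity (eigenProj (H 1) (lam 1)) (ρ 1) := by
  have hI : uIcc (0 : ℝ) 1 = Icc 0 1 := uIcc_of_le zero_le_one
  have hgc : ContinuousOn g₀ (Icc 0 1) := hI ▸ hg.continuousOn
  obtain ⟨hB₂pos, hwi, hwB⟩ := hH.weight_bounds hgc hm hB₂
  set w : ℝ → ℝ := fun s => g₀ s ^ (p - 3) * gmin ^ (2 - p) with hw
  set k : ℝ → ℝ := fun s => c / (ε * g₀ s ^ p * gmin ^ (2 - p)) with hk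
  have hw0 : ∀ s ∈ Icc (0 : ℝ) 1, 0 ≤ w s := fun s hs => by
    have := hH.gap_pos s hs
    positivity
  have hkinv : (fun s => (k s)⁻¹) = fun s => ε / c * gmin ^ (2 - p) * g₀ s ^ p := by
    ext1 s
    rw [hk, inv_div]
    ring
  have hgp := absolutelyContinuousOnInterval_rpow hg hH.gap_pos p
  have hkac : AbsolutelyContinuousOnInterval k 0 1 := by
    have h1 := (absolutelyContinuousOnInterval_inv hgp fun s hs =>
      Real.rpow_pos_of_pos (hH.gap_pos s hs) p).const_mul (c / (ε * gmin ^ (2 - p)))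
    refine absolutelyContinuousOnInterval_of_dist_le zero_le_one h1 fun x _ y _ => ?_
    rw [one_mul]
    refine le_of_eq ?_
    congr 1 <;> rw [hk] <;> field_simp
  have hkpos : ∀ s ∈ Icc (0 : ℝ) 1, 0 < k s := fun s hs => by
    have := hH.gap_pos s hs
    positivity
  have hmain := hH.one_sub_fidelity_le hgc hkpos hkac hρ
  have hd : ∀ s ∈ Icc (0 : ℝ) 1, ‖redRes H lam s‖ ≤ (max (g₀ s) gmin)⁻¹ :=
    fun s hs => hH.norm_redRes_le_of_le_spectralGap hs (hgap s hs)
  have hmem : ∀ᵐ s ∂(volume.restrict (Icc (0 : ℝ) 1)), s ∈ Icc (0 : ℝ) 1 :=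
    ae_restrict_mem measurableSet_Icc
  have hp0 : 0 < p := by linarith
  -- Here only `g₀ᵖ gmin²⁻ᵖ ‖S‖² ≤ 1` and `4 ‖H'(1)‖ ≤ c` enter.
  have hT1 : (k 1)⁻¹ * ‖gapCommutator H lam 1‖ ≤ ε * (1 / 4) := by
    have h1 : (1 : ℝ) ∈ Icc (0 : ℝ) 1 := ⟨zero_le_one, le_rfl⟩
    have hg1 := hH.gap_pos 1 h1
    have h2 := hH.norm_gapCommutator_le hgc h1 (hd 1 h1)
    have h3 := rpow_mul_rpow_mul_le_one hg1 hm hp1 hp2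
    rw [show (k 1)⁻¹ = ε / c * gmin ^ (2 - p) * g₀ 1 ^ p from congrFun hkinv 1]
    calc ε / c * gmin ^ (2 - p) * g₀ 1 ^ p * ‖gapCommutator H lam 1‖
        ≤ ε / c * gmin ^ (2 - p) * g₀ 1 ^ p * (‖H₁ 1‖ * (max (g₀ 1) gmin)⁻¹ ^ 2) := by gcongr
      _ = ε / c * ‖H₁ 1‖ * (g₀ 1 ^ p * gmin ^ (2 - p) * (max (g₀ 1) gmin)⁻¹ ^ 2) := by ring
      _ ≤ ε / c * ‖H₁ 1‖ * 1 := by gcongr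
      _ ≤ ε / c * (c / 4) := by rw [mul_one]; gcongr; linarith
      _ = ε * (1 / 4) := by field_simp
  -- The `‖H'‖²` part of `C'` is integrated against the weight, the `‖H''‖` part is bounded pointwise;
  -- the hypothesis on `c` gives `8 ‖H'‖² ≤ c / (5 B₂)` and `‖H''‖ ≤ c / 4`.
  have hT2 : (∫⁻ s in Icc (0 : ℝ) 1,
      ENNReal.ofReal ((k s)⁻¹ * ‖derivWithin (gapCommutator H lam) (Icc 0 1) s‖)) ≤
      ENNReal.ofReal (ε * (1 / 5 + 1 / 4)) := by
    have hpt : ∀ᵐ s ∂(volume.restrict (Icc (0 : ℝ) 1)),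
        ENNReal.ofReal ((k s)⁻¹ * ‖derivWithin (gapCommutator H lam) (Icc 0 1) s‖) ≤
          ENNReal.ofReal (ε / (5 * B₂) * w s + ε * (1 / 4)) := by
      filter_upwards [hc, hmem] with s hcs hs
      refine ENNReal.ofReal_le_ofReal ?_
      have hgs := hH.gap_pos s hs
      have h2 := hH.norm_derivWithin_gapCommutator_le hgc hs (hd s hs)
      have h3 := rpow_mul_rpow_mul_le_one hgs hm hp1 hp2
      have h4 : g₀ s ^ p * (max (g₀ s) gmin)⁻¹ ^ 3 ≤ g₀ s ^ (p - 3) := by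
        simpa using rpow_mul_inv_max_pow_le (m := gmin) hgs p 3
      have h5 : 0 ≤ 6 * p * |derivWithin g₀ (Icc 0 1) s| * ‖H₁ s‖ * B₂ := by positivity
      have h6 : 0 ≤ 40 * ‖H₁ s‖ ^ 2 * B₂ := by positivity
      have h7 : 8 * ‖H₁ s‖ ^ 2 ≤ c / (5 * B₂) := by
        rw [le_div_iff₀ (by positivity)]
        linarith [norm_nonneg (H₁ s), norm_nonneg (H₂ s)]
      have h8 : ‖H₂ s‖ ≤ c / 4 := by linarith [norm_nonneg (H₁ s)]
      have hws := hw0 s hs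
      rw [show (k s)⁻¹ = ε / c * gmin ^ (2 - p) * g₀ s ^ p from congrFun hkinv s]
      calc ε / c * gmin ^ (2 - p) * g₀ s ^ p * ‖derivWithin (gapCommutator H lam) (Icc 0 1) s‖
          ≤ ε / c * gmin ^ (2 - p) * g₀ s ^ p * (8 * ‖H₁ s‖ ^ 2 * (max (g₀ s) gmin)⁻¹ ^ 3 +
              ‖H₂ s‖ * (max (g₀ s) gmin)⁻¹ ^ 2) := by gcongr
        _ = ε / c * (8 * ‖H₁ s‖ ^ 2) *
              ((g₀ s ^ p * (max (g₀ s) gmin)⁻¹ ^ 3) * gmin ^ (2 - p)) +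
            ε / c * ‖H₂ s‖ * (g₀ s ^ p * gmin ^ (2 - p) * (max (g₀ s) gmin)⁻¹ ^ 2) := by ring
        _ ≤ ε / c * (c / (5 * B₂)) * (g₀ s ^ (p - 3) * gmin ^ (2 - p)) +
            ε / c * (c / 4) * 1 := by gcongr
        _ = ε / (5 * B₂) * w s + ε * (1 / 4) := by rw [hw]; field_simp
    refine (lintegral_mono_ae hpt).trans ?_
    have hint : Integrable (fun s => ε / (5 * B₂) * w s + ε * (1 / 4))
        (volume.restrict (Icc (0 : ℝ) 1)) := (hwi.const_mul _).add (integrable_const _)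
    rw [← ofReal_integral_eq_lintegral_ofReal hint (hmem.mono fun s hs => by
      have := hw0 s hs
      positivity)]
    refine ENNReal.ofReal_le_ofReal ?_
    rw [integral_add (hwi.const_mul _) (integrable_const _), integral_const_mul]
    simp only [integral_const, measureReal_restrict_apply_univ, Real.volume_real_Icc, sub_zero,
      zero_le_one, sup_of_le_left, one_smul, mul_add]
    refine add_le_add ((mul_le_mul_of_nonneg_left hwB (by positivity)).trans_eq ?_) le_rfl
    field_simp
  -- `(1 / K')'` is `p g₀ᵖ⁻¹ g₀'` up to a constant, so that dividing by `g₀²` leaves the weight again.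
  have hT3 : (∫⁻ s in Icc (0 : ℝ) 1,
      ENNReal.ofReal (|derivWithin (fun t => (k t)⁻¹) (Icc 0 1) s| * ‖gapCommutator H lam s‖)) ≤
      ENNReal.ofReal (ε * (1 / 6)) := by
    have hdiff : ∀ᵐ s ∂(volume.restrict (Icc (0 : ℝ) 1)), DifferentiableAt ℝ g₀ s := by
      rw [ae_restrict_iff' measurableSet_Icc]
      simpa only [hI] using hg.ae_differentiableAt
    have hpt : ∀ᵐ s ∂(volume.restrict (Icc (0 : ℝ) 1)),
        ENNReal.ofReal (|derivWithin (fun t => (k t)⁻¹) (Icc 0 1) s| *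
          ‖gapCommutator H lam s‖) ≤ ENNReal.ofReal (ε / (6 * B₂) * w s) := by
      filter_upwards [hc, hmem, hdiff] with s hcs hs hds
      refine ENNReal.ofReal_le_ofReal ?_
      have hgs := hH.gap_pos s hs
      have hder : derivWithin (fun t => (k t)⁻¹) (Icc 0 1) s =
          ε / c * gmin ^ (2 - p) * (derivWithin g₀ (Icc 0 1) s * p * g₀ s ^ (p - 1)) := by
        rw [hkinv]
        exact ((hds.differentiableWithinAt.hasDerivWithinAt.rpow_const
          (Or.inl hgs.ne')).const_mul _).derivWithin (uniqueDiffOn_Icc zero_lt_one s hs)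
      have h2 := hH.norm_gapCommutator_le hgc hs (hd s hs)
      have h4 : g₀ s ^ (p - 1) * (max (g₀ s) gmin)⁻¹ ^ 2 ≤ g₀ s ^ (p - 3) := by
        have := rpow_mul_inv_max_pow_le (m := gmin) hgs (p - 1) 2
        rwa [show p - 1 - ((2 : ℕ) : ℝ) = p - 3 by push_cast; ring] at this
      have h6 : 0 ≤ 40 * ‖H₁ s‖ ^ 2 * B₂ := by positivity
      have h7 : p * |derivWithin g₀ (Icc 0 1) s| * ‖H₁ s‖ ≤ c / (6 * B₂) := by
        rw [le_div_iff₀ (by positivity)]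
        linarith [norm_nonneg (H₁ s), norm_nonneg (H₂ s)]
      rw [hder, abs_mul, abs_of_nonneg (show 0 ≤ ε / c * gmin ^ (2 - p) by positivity),
        abs_mul, abs_mul, abs_of_pos hp0,
        abs_of_nonneg (show 0 ≤ g₀ s ^ (p - 1) by positivity)]
      calc ε / c * gmin ^ (2 - p) * (|derivWithin g₀ (Icc 0 1) s| * p * g₀ s ^ (p - 1)) *
            ‖gapCommutator H lam s‖
          ≤ ε / c * gmin ^ (2 - p) * (|derivWithin g₀ (Icc 0 1) s| * p * g₀ s ^ (p - 1)) *
            (‖H₁ s‖ * (max (g₀ s) gmin)⁻¹ ^ 2) := by gcongr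
        _ = ε / c * (p * |derivWithin g₀ (Icc 0 1) s| * ‖H₁ s‖) *
            ((g₀ s ^ (p - 1) * (max (g₀ s) gmin)⁻¹ ^ 2) * gmin ^ (2 - p)) := by ring
        _ ≤ ε / c * (c / (6 * B₂)) * (g₀ s ^ (p - 3) * gmin ^ (2 - p)) := by gcongr
        _ = ε / (6 * B₂) * w s := by rw [hw]; field_simp
    refine (lintegral_mono_ae hpt).trans ?_
    rw [← ofReal_integral_eq_lintegral_ofReal (hwi.const_mul _) (hmem.mono fun s hs => by
      have := hw0 s hs
      positivity)]
    refine ENNReal.ofReal_le_ofReal ?_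
    rw [integral_const_mul]
    refine (mul_le_mul_of_nonneg_left hwB (by positivity)).trans_eq ?_
    field_simp
  have hsum := hmain.trans (add_le_add (add_le_add (ENNReal.ofReal_le_ofReal hT1) hT2) hT3)
  rw [← ENNReal.ofReal_add (by positivity) (by positivity),
    ← ENNReal.ofReal_add (by positivity) (by positivity),
    ENNReal.ofReal_le_ofReal_iff (by positivity)] at hsum
  linarith

end IsGappedPath
end Adiabatic

/-! ### Error bound and running time -/

theorem theoremA1 {E : Type*} [NormedAddCommGroup E] [InnerProductSpace ℂ E]
    [FiniteDimensional ℂ E] [CompleteSpace E]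
    (H H₁ H₂ : ℝ → E →L[ℂ] E) (lam g₀ : ℝ → ℝ)
    (hH : IsGappedPath H H₁ H₂ lam g₀) (hg₀ : AbsolutelyContinuousOnInterval g₀ 0 1) :
    (DifferentiableOn ℝ (fun s => eigenProj (H s) (lam s)) (Icc 0 1) ∧
      DifferentiableOn ℝ (gapCommutator H lam) (Icc 0 1) ∧
      ∀ K K₁ : ℝ → ℝ,
        (∀ s ∈ Icc (0 : ℝ) 1, HasDerivWithinAt K (K₁ s) (Icc 0 1) s) →
        (∀ s ∈ Icc (0 : ℝ) 1, 0 < K₁ s) →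
        AbsolutelyContinuousOnInterval K₁ 0 1 →
        ∀ ρ : ℝ → E →L[ℂ] E, IsEvolution H lam K₁ ρ →
          ENNReal.ofReal (1 - fidelity (eigenProj (H 1) (lam 1)) (ρ 1)) ≤
            ENNReal.ofReal ((K₁ 1)⁻¹ * ‖gapCommutator H lam 1‖) +
            (∫⁻ s in Icc (0 : ℝ) 1,
              ENNReal.ofReal ((K₁ s)⁻¹ * ‖derivWithin (gapCommutator H lam) (Icc 0 1) s‖)) +
            ∫⁻ s in Icc (0 : ℝ) 1,
              ENNReal.ofReal (|derivWithin (fun t => (K₁ t)⁻¹) (Icc 0 1) s| * ‖gapCommutator H lam s‖)) ∧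
    (∀ p B₁ B₂ gmin c ε : ℝ, 1 ≤ p → p ≤ 2 → 0 < ε → 0 < gmin →
      (∀ s ∈ Icc (0 : ℝ) 1, ENNReal.ofReal gmin ≤ spectralGap (H s) (lam s)) →
      (∫ s in (0 : ℝ)..1, g₀ s ^ (-p)) ≤ B₁ * gmin ^ (1 - p) →
      (∫ s in (0 : ℝ)..1, g₀ s ^ (p - 3)) ≤ B₂ * gmin ^ (p - 2) →
      (∀ᵐ s ∂(volume.restrict (Icc (0 : ℝ) 1)),
        4 * ‖H₁ s‖ + 40 * ‖H₁ s‖ ^ 2 * B₂ + 4 * ‖H₂ s‖ +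
          6 * p * |derivWithin g₀ (Icc 0 1) s| * ‖H₁ s‖ * B₂ ≤ c) →
      ∀ K : ℝ → ℝ, K 0 = 0 →
        (∀ s ∈ Icc (0 : ℝ) 1,
          HasDerivWithinAt K (c / (ε * g₀ s ^ p * gmin ^ (2 - p))) (Icc 0 1) s) →
        K 1 = (∫ s in (0 : ℝ)..1, c / (ε * g₀ s ^ p * gmin ^ (2 - p))) ∧
        K 1 ≤ c * B₁ / (ε * gmin) ∧
        ∀ ρ : ℝ → E →L[ℂ] E,
          IsEvolution H lam (fun s => c / (ε * g₀ s ^ p * gmin ^ (2 - p))) ρ →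
          1 - ε ≤ fidelity (eigenProj (H 1) (lam 1)) (ρ 1)) := by
  have hgc : ContinuousOn g₀ (Icc 0 1) := by
    simpa only [uIcc_of_le (zero_le_one (α := ℝ))] using hg₀.continuousOn
  refine ⟨⟨fun s hs => (hH.hasDerivWithinAt_proj hgc hs).differentiableWithinAt,
    hH.differentiableOn_gapCommutator hgc, fun K K₁ _ hpos hac ρ hρ =>
      hH.one_sub_fidelity_le hgc hpos hac hρ⟩, ?_⟩
  intro p B₁ B₂ gmin c ε hp1 hp2 hε hm hgap hB₁ hB₂ hc K hK0 hK
  obtain ⟨hB₂pos, -, -⟩ := hH.weight_bounds hgc hm hB₂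
  have hp0 : 0 < p := by linarith
  -- Only the continuous part of the hypothesis on `c` extends from almost every point to all.
  have hc1 : ∀ s ∈ Icc (0 : ℝ) 1, 4 * ‖H₁ s‖ ≤ c := by
    refine le_of_ae_le_of_continuousOn (continuousOn_const.mul
      (fun s hs => (hH.hasDeriv₂ s hs).continuousWithinAt.norm)) (hc.mono fun s hs => ?_)
    have h1 : 0 ≤ 40 * ‖H₁ s‖ ^ 2 * B₂ := by positivity
    have h2 : 0 ≤ 6 * p * |derivWithin g₀ (Icc 0 1) s| * ‖H₁ s‖ * B₂ := by positivity
    linarith [norm_nonneg (H₂ s)]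
  have h1 : (1 : ℝ) ∈ Icc (0 : ℝ) 1 := ⟨zero_le_one, le_rfl⟩
  have hc0 : 0 ≤ c := (by positivity : 0 ≤ 4 * ‖H₁ 1‖).trans (hc1 1 h1)
  have hkc := hH.continuousOn_schedule (p := p) (c := c) hgc hε hm
  have hK1 : K 1 = ∫ s in (0 : ℝ)..1, c / (ε * g₀ s ^ p * gmin ^ (2 - p)) := by
    rw [intervalIntegral.integral_eq_sub_of_hasDerivAt_of_le zero_le_one
      (fun s hs => (hK s hs).continuousWithinAt)
      (fun s hs => hasDerivAt_of_Icc (hK s (Ioo_subset_Icc_self hs)) hs)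
      (ContinuousOn.intervalIntegrable_of_Icc zero_le_one hkc), hK0, sub_zero]
  refine ⟨hK1, hK1.trans_le (hH.integral_schedule_le hε hm hc0 hB₁), fun ρ hρ => ?_⟩
  rcases hc0.eq_or_lt with rfl | hcpos
  · have h0 : ∀ s ∈ Icc (0 : ℝ) 1, H₁ s = 0 := fun s hs =>
      norm_le_zero_iff.mp (by linarith [hc1 s hs])
    rw [hH.fidelity_eq_one_of_H₁_eq_zero hgc h0 hρ]
    linarith
  · exact hH.one_sub_le_fidelity_of_pos hg₀ hp1 hp2 hε hm hgap hB₂ hc hcpos (hc1 1 h1) hρ
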